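/- **Setting.** Let $(S,\mathcal F,P)$ be a probability space, with outer and inner probabilities $P^*$ and $P_*(A)=1-P^*(A^c)$; $\to_p$ denotes convergence in outer probability, $|\cdot|$ the Euclidean norm and $n\to\infty$ along the positive integers. Let $\Theta\subset\mathbb R^d$ be compact and convex, let $\theta_0$ be in the interior of $\Theta$, and let $\pi$ be a continuous probability density on $\Theta$ that is bounded below by a positive constant. For each $n$ let $L_n(\theta)$, $\theta\in\Theta$, be a real-valued random criterion function, measurable in $\theta$ for each outcome and measurable in the outcome for each $\theta$. Assume: (1) (Identifiability) for every $\delta>0$ there is $\epsilon>0$ with $$\liminf_{n\to\infty}P_*\Big\{\sup_{\theta\in\Theta,\ |\theta-\theta_0|\ge\delta}\tfrac1n\big(L_n(\theta)-L_n(\theta_0)\big)\le-\epsilon\Big\}=1 .$$ (2) (Expansion) there are random vectors $\Delta_n$ and nonrandom symmetric $d\times d$ matrices $J_n$ and $\Omega_n$ such that $J_n$ and $\Omega_n$ are bounded and positive definite, both uniformly in $n$; $\Omega_n^{-1/2}\Delta_n/\sqrt n$ converges in distribution to $\mathcal N(0,I)$; and, with $R_n$ defined by $$L_n(\theta)-L_n(\theta_0)=(\theta-\theta_0)'\Delta_n-\tfrac12(\theta-\theta_0)'[nJ_n](\theta-\theta_0)+R_n(\theta),$$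 for each $\epsilon>0$ there are $\delta>0$ and $M>0$ with $$\limsup_{n\to\infty}P^*\Big\{\sup_{\theta\in\Theta,\ M/\sqrt n\le|\theta-\theta_0|\le\delta}\frac{|R_n(\theta)|}{n|\theta-\theta_0|^2}>\epsilon\Big\}<\epsilon,\qquad \limsup_{n\to\infty}P^*\Big\{\sup_{\theta\in\Theta,\ |\theta-\theta_0|\le M/\sqrt n}|R_n(\theta)|>\epsilon\Big\}=0 .$$ Define the quasi-posterior density $p_n(\theta)=e^{L_n(\theta)}\pi(\theta)\big/\int_\Theta e^{L_n(t)}\pi(t)\,dt$, its mean $\widehat\theta=\int_\Theta\theta\,p_n(\theta)\,d\theta$, and $n$ times its covariance matrix $$\widehat J_n^{-1}=\int_\Theta n(\theta-\widehat\theta)(\theta-\widehat\theta)'\,p_n(\theta)\,d\theta .$$ **Theorem 4 (Large Sample Inference II).** Under these assumptions, $\widehat J_n^{-1}-J_n^{-1}\to_p 0$ and $\widehat J_nJ_n^{-1}\to_p I$. Moreover, let $\widehat\Omega_n$ be any random matrices with $\widehat\Omega_n\Omega_n^{-1}\to_p I$, let $g:\Theta\to\mathbb R$ be continuously differentiable on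 the interior of $\Theta$ with $\nabla g(\theta_0)\ne0$, let $\alpha\in(0,1)$, let $q_\tau$ be the $\tau$-quantile of $\mathcal N(0,1)$, and put $$c_{g,n}(\tau)=g(\widehat\theta)+q_\tau\,\frac{\sqrt{\nabla g(\widehat\theta)'\,\widehat J_n^{-1}\,\widehat\Omega_n\,\widehat J_n^{-1}\,\nabla g(\widehat\theta)}}{\sqrt n}.$$ Then $$\lim_{n\to\infty}P_*\big\{c_{g,n}(\alpha/2)\le g(\theta_0)\le c_{g,n}(1-\alpha/2)\big\}=1-\alpha .$$ No relation between $J_n$ and $\Omega_n$ (no information equality) is assumed. (Quantities such as $p_n$, $\nabla g(\widehat\theta)$, $\widehat J_n$ and the square root may be given arbitrary values on the events, of outer probability tending to $0$, on which they are not defined.) -/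

import Mathlib

open MeasureTheory ProbabilityTheory Filter Topology Matrix
open scoped ENNReal MatrixOrder

namespace LTE

noncomputable section

/-- Inner probability of an arbitrary event. A `Measure` in Mathlib, evaluated at an arbitrary
(possibly non-measurable) set, is the outer probability of that set, so this is
`1 - P^*(complement)`. -/
def innerProb {S : Type*} [MeasurableSpace S] (P : Measure S) (A : Set S) : ℝ≥0∞ :=
  1 - P Aᶜ

/-- Convergence in outer probability of a sequence of random matrices (entry by entry, which is
the same as convergence in any matrix norm) to a constant matrix. -/
def MatrixTendstoInProb {S : Type*} [MeasurableSpace S] (P : Measure S) {d : ℕ}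
    (A : ℕ → S → Matrix (Fin d) (Fin d) ℝ) (B : Matrix (Fin d) (Fin d) ℝ) : Prop :=
  ∀ i j, TendstoInMeasure P (fun n ω => A n ω i j) atTop (fun _ => B i j)

/-- The quadratic form `x' A x`. -/
def quadForm {d : ℕ} (A : Matrix (Fin d) (Fin d) ℝ) (x : EuclideanSpace ℝ (Fin d)) : ℝ :=
  x.ofLp ⬝ᵥ (A *ᵥ x.ofLp)

/-- The `p`-quantile of the standard normal distribution (used for `0 < p < 1`). -/
def stdNormalQuantile (p : ℝ) : ℝ :=
  sInf {x : ℝ | p ≤ cdf (gaussianReal 0 1) x}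

/-! ### The quasi-posterior -/

/-- The quasi-posterior density `e^{ℓ(θ)} π(θ) / ∫_Θ e^{ℓ(t)} π(t) dt` of a criterion function
`ℓ` and a weighting function `π` on the parameter space `Θ`. -/
def quasiPosterior {d : ℕ} (Θ : Set (EuclideanSpace ℝ (Fin d)))
    (π ℓ : EuclideanSpace ℝ (Fin d) → ℝ) (θ : EuclideanSpace ℝ (Fin d)) : ℝ :=
  Real.exp (ℓ θ) * π θ / ∫ t in Θ, Real.exp (ℓ t) * π t

/-- The quasi-posterior mean. -/
def quasiMean {d : ℕ} (Θ : Set (EuclideanSpace ℝ (Fin d)))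
    (π ℓ : EuclideanSpace ℝ (Fin d) → ℝ) : EuclideanSpace ℝ (Fin d) :=
  ∫ θ in Θ, quasiPosterior Θ π ℓ θ • θ

/-- `n` times the quasi-posterior covariance matrix,
`∫_Θ n (θ - θhat)(θ - θhat)' p_n(θ) dθ` with `θhat` the quasi-posterior mean. -/
def scaledQuasiCov {d : ℕ} (Θ : Set (EuclideanSpace ℝ (Fin d)))
    (π ℓ : EuclideanSpace ℝ (Fin d) → ℝ) (n : ℕ) : Matrix (Fin d) (Fin d) ℝ :=
  Matrix.of fun i j =>
    ∫ θ in Θ, (n : ℝ) * ((θ i - quasiMean Θ π ℓ i) * (θ j - quasiMean Θ π ℓ j)) *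
      quasiPosterior Θ π ℓ θ

/-- The delta-method confidence bound
`g(θhat) + q_p * sqrt(∇g(θhat)' V Om V ∇g(θhat)) / sqrt n`, where `θhat` is the quasi-posterior
mean, `V` is `n` times the quasi-posterior covariance matrix and `Om` is an estimate of the
variance matrix of the score. -/
def confBound {d : ℕ} (Θ : Set (EuclideanSpace ℝ (Fin d)))
    (π ℓ : EuclideanSpace ℝ (Fin d) → ℝ) (n : ℕ) (Om : Matrix (Fin d) (Fin d) ℝ)
    (g : EuclideanSpace ℝ (Fin d) → ℝ) (p : ℝ) : ℝ :=
  g (quasiMean Θ π ℓ) +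
    stdNormalQuantile p *
      (Real.sqrt (quadForm (scaledQuasiCov Θ π ℓ n * Om * scaledQuasiCov Θ π ℓ n)
        (gradient g (quasiMean Θ π ℓ))) / Real.sqrt n)

/-! ### The assumptions -/

/-- The parameter space is compact and convex and the true parameter is in its interior. -/
structure ParameterAssumption {d : ℕ} (Θ : Set (EuclideanSpace ℝ (Fin d)))
    (θ₀ : EuclideanSpace ℝ (Fin d)) : Prop where
  isCompact : IsCompact Θ
  convex : Convex ℝ Θ
  mem_interior : θ₀ ∈ interior Θ

/-- The weighting function is a continuous, uniformly positive density on `Θ`. -/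
structure PriorAssumption {d : ℕ} (Θ : Set (EuclideanSpace ℝ (Fin d)))
    (π : EuclideanSpace ℝ (Fin d) → ℝ) : Prop where
  continuousOn : ContinuousOn π Θ
  uniformly_pos : ∃ c > 0, ∀ θ ∈ Θ, c ≤ π θ
  integral_eq_one : ∫ θ in Θ, π θ = 1

/-- Standard measurability of the criterion functions: `L_n(θ)` is measurable in `θ ∈ Θ` for each
outcome, and is a random variable for each `θ ∈ Θ`. No joint measurability is required. -/
structure CriterionMeasurable {d : ℕ} {S : Type*} [MeasurableSpace S]
    (Θ : Set (EuclideanSpace ℝ (Fin d)))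
    (L : ℕ → EuclideanSpace ℝ (Fin d) → S → ℝ) : Prop where
  measurable_param : ∀ n ω, Measurable (fun θ : Θ => L n (θ : EuclideanSpace ℝ (Fin d)) ω)
  measurable_outcome : ∀ n, ∀ θ ∈ Θ, Measurable (L n θ)

/-- Identifiability: for each `δ > 0` there is `ε > 0` such that the inner probability of
`sup_{θ ∈ Θ, |θ - θ₀| ≥ δ} (L_n(θ) - L_n(θ₀)) / n ≤ -ε` has lower limit one. -/
def IdentifiabilityAssumption {d : ℕ} {S : Type*} [MeasurableSpace S] (P : Measure S)
    (Θ : Set (EuclideanSpace ℝ (Fin d))) (θ₀ : EuclideanSpace ℝ (Fin d))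
    (L : ℕ → EuclideanSpace ℝ (Fin d) → S → ℝ) : Prop :=
  ∀ δ > 0, ∃ ε > 0,
    liminf (fun n : ℕ => innerProb P
      {ω | ∀ θ ∈ Θ, δ ≤ ‖θ - θ₀‖ → (1 / (n : ℝ)) * (L n θ ω - L n θ₀ ω) ≤ -ε}) atTop = 1

/-- The remainder `R_n(θ)` of the quadratic expansion of the criterion function at `θ₀`,
`L_n(θ) - L_n(θ₀) = (θ - θ₀)' Δ_n - (1/2) (θ - θ₀)' [n J_n] (θ - θ₀) + R_n(θ)`. -/
def remainder {d : ℕ} {S : Type*} (θ₀ : EuclideanSpace ℝ (Fin d))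
    (L : ℕ → EuclideanSpace ℝ (Fin d) → S → ℝ) (Δ : ℕ → S → EuclideanSpace ℝ (Fin d))
    (J : ℕ → Matrix (Fin d) (Fin d) ℝ) (n : ℕ) (θ : EuclideanSpace ℝ (Fin d)) (ω : S) : ℝ :=
  L n θ ω - L n θ₀ ω - (inner ℝ (θ - θ₀) (Δ n ω) - 1 / 2 * quadForm ((n : ℝ) • J n) (θ - θ₀))

/-- A sequence of constant symmetric matrices that is `O(1)` and positive definite uniformly
in `n`. -/
structure BoundedUniformlyPosDef {d : ℕ} (A : ℕ → Matrix (Fin d) (Fin d) ℝ) : Prop where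
  isSymm : ∀ n ≥ 1, (A n).IsSymm
  bounded : ∃ C : ℝ, ∀ n ≥ 1, ∀ i j, |A n i j| ≤ C
  uniformly_pos : ∃ c > 0, ∀ n ≥ 1, ∀ x, c * ‖x‖ ^ 2 ≤ quadForm (A n) x

/-- The stochastic quadratic expansion of the criterion function at `θ₀` with score `Δ_n`,
curvature `J_n` and score variance `Om_n`. A supremum over a set of `θ` exceeds `ε`
exactly when some `θ` in the set does. -/
structure ExpansionAssumption {d : ℕ} {S : Type*} [MeasurableSpace S]
    (P : Measure S) [IsProbabilityMeasure P]
    (Θ : Set (EuclideanSpace ℝ (Fin d))) (θ₀ : EuclideanSpace ℝ (Fin d))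
    (L : ℕ → EuclideanSpace ℝ (Fin d) → S → ℝ) (Δ : ℕ → S → EuclideanSpace ℝ (Fin d))
    (J Om : ℕ → Matrix (Fin d) (Fin d) ℝ) : Prop where
  /-- `Om_n^{-1/2} Δ_n / sqrt n` converges in distribution to `N(0, I)`. -/
  score_clt : TendstoInDistribution
    (fun (n : ℕ) ω => Matrix.toEuclideanCLM (𝕜 := ℝ) (CFC.sqrt (Om n)⁻¹)
      ((Real.sqrt n)⁻¹ • Δ n ω))
    atTop (id : EuclideanSpace ℝ (Fin d) → EuclideanSpace ℝ (Fin d))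
    (fun _ => P) (stdGaussian (EuclideanSpace ℝ (Fin d)))
  curvature : BoundedUniformlyPosDef J
  variance : BoundedUniformlyPosDef Om
  remainder_small : ∀ ε > 0, ∃ δ > 0, ∃ M > 0,
    limsup (fun n : ℕ => P {ω | ∃ θ ∈ Θ, M / Real.sqrt n ≤ ‖θ - θ₀‖ ∧ ‖θ - θ₀‖ ≤ δ ∧
      ε < |remainder θ₀ L Δ J n θ ω| / (n * ‖θ - θ₀‖ ^ 2)}) atTop < ENNReal.ofReal ε ∧
    limsup (fun n : ℕ => P {ω | ∃ θ ∈ Θ, ‖θ - θ₀‖ ≤ M / Real.sqrt n ∧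
      ε < |remainder θ₀ L Δ J n θ ω|}) atTop = 0

end

end LTE

open LTE

/-!
The proof turns the stochastic statement into a deterministic one, by selecting outcomes.

Write `h = √n (θ - θ₀)` for the local parameter. Along a *deterministic* sequence of criterion
functions with a quadratic expansion, converging curvature `J n → J₀` and converging score
`Δ_n / √n → x₀` (`QuadraticAlong`), the quasi-posterior weight in `h` converges pointwise to a
multiple of the Gaussian weight `exp (h' x₀ - h' J₀ h / 2)` and has a uniform Gaussian tail: near
`θ₀` the expansion leaves a quarter of the lower bound for the curvature, and away from `θ₀` the
separation bound gives `-ε n ≤ -a |h|²` because the parameter space is bounded. Dominated convergence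
yields the limits of the zeroth, first and second moments. Integration by parts gives the normal
equations `J₀ m = x₀` and `J₀ E[h h'] = I + x₀ m'` of the Gaussian weight, so that the limiting mean
is `J₀⁻¹ x₀` and the limiting covariance is `J₀⁻¹`; the Gaussian normalizing constant is not needed.

If the outer probabilities of some events do not tend to zero, then subadditivity alone allows one
to pick outcomes in these events, along a subsequence, at which all the high-probability properties
hold asymptotically (`exists_subseq_mem`). By compactness a further subsequence makes `J n`, `Om n`,
the inverse square root of `Om n` and the standardized score converge (`exists_convergentPath`), and
the deterministic result contradicts the choice of the events. This gives the consistency of the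
scaled quasi-posterior covariance and of its inverse without any joint measurability.

For the coverage, pass to a subsequence along which the matrices converge. The same selection
principle shows that `√n (g θ₀ - g θhat) / σhat` is close in outer probability to `a' Z_n`, where
`Z_n` is the standardized score and `a` is a fixed unit vector: this is where the sandwich form of
`σhat` enters (`sandwich_identities`). Since `a' Z_n` is asymptotically standard normal, a sandwich
argument (`tendsto_innerProb_of_close`) and the continuity of the normal distribution function
finish the proof.
-/

/-! ### Gaussian integrals -/

variable {d : ℕ}

/-- The unnormalized Gaussian density `exp (h' x - h' J h / 2)`; it is proportional to the density
of `N(J⁻¹ x, J⁻¹)`. -/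
noncomputable def gaussianWeight (J : Matrix (Fin d) (Fin d) ℝ) (x h : EuclideanSpace ℝ (Fin d)) :
    ℝ :=
  Real.exp (inner ℝ h x - 1 / 2 * quadForm J h)

lemma integrable_exp_neg_mul_sq_norm {b : ℝ} (hb : 0 < b) :
    Integrable (fun h : EuclideanSpace ℝ (Fin d) => Real.exp (-(b * ‖h‖ ^ 2))) := by
  have h := (GaussianFourier.integrable_cexp_neg_mul_sq_norm_add (V := EuclideanSpace ℝ (Fin d))
    (b := (b : ℂ)) (by simpa using hb) 0 0).norm
  refine h.congr (Eventually.of_forall fun v => ?_)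
  simp only [Complex.norm_exp]
  congr 1
  simp [← Complex.ofReal_pow]

/-- A polynomial factor and a linear term in the exponent are absorbed by half of the quadratic
decay. -/
lemma exists_one_add_sq_mul_exp_le (C : ℝ) {a : ℝ} (ha : 0 < a) :
    ∃ K : ℝ, 0 < K ∧ ∀ r : ℝ, (1 + r ^ 2) * Real.exp (C * r - a * r ^ 2) ≤
      K * Real.exp (-(a / 2 * r ^ 2)) := by
  refine ⟨(1 + 4 / a) * Real.exp (C ^ 2 / a), by positivity, fun r => ?_⟩
  have h1 : 1 + r ^ 2 ≤ (1 + 4 / a) * Real.exp (a / 4 * r ^ 2) := by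
    have h2 := Real.add_one_le_exp (a / 4 * r ^ 2)
    have h3 : (1 + 4 / a) * (a / 4 * r ^ 2 + 1) = 1 + r ^ 2 + (4 / a + a / 4 * r ^ 2) := by
      field_simp
      ring
    have h4 : (1 + 4 / a) * (a / 4 * r ^ 2 + 1) ≤ (1 + 4 / a) * Real.exp (a / 4 * r ^ 2) := by
      gcongr
    have : 0 ≤ 4 / a + a / 4 * r ^ 2 := by positivity
    linarith
  have h5 : C * r - a * r ^ 2 ≤ C ^ 2 / a - 3 / 4 * a * r ^ 2 := by
    have : 0 ≤ (C - a / 2 * r) ^ 2 / a := by positivity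
    have h6 : (C - a / 2 * r) ^ 2 / a = C ^ 2 / a - C * r + a / 4 * r ^ 2 := by
      field_simp
      ring
    linarith
  calc (1 + r ^ 2) * Real.exp (C * r - a * r ^ 2)
      ≤ ((1 + 4 / a) * Real.exp (a / 4 * r ^ 2)) * Real.exp (C ^ 2 / a - 3 / 4 * a * r ^ 2) := by
        gcongr
    _ = _ := by
        rw [mul_assoc (1 + 4 / a), mul_assoc (1 + 4 / a), ← Real.exp_add, ← Real.exp_add]
        congr 2
        ring

lemma abs_coord_le_norm (h : EuclideanSpace ℝ (Fin d)) (i : Fin d) : |h i| ≤ ‖h‖ := by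
  simpa using PiLp.norm_apply_le h i

lemma quadForm_eq_sum (A : Matrix (Fin d) (Fin d) ℝ) (h : EuclideanSpace ℝ (Fin d)) :
    quadForm A h = ∑ i, h i * ∑ j, A i j * h j := by
  simp [quadForm, dotProduct, mulVec]

@[fun_prop]
lemma continuous_quadForm (A : Matrix (Fin d) (Fin d) ℝ) : Continuous (quadForm A) := by
  have : quadForm A = fun h => ∑ i, h i * ∑ j, A i j * h j := funext (quadForm_eq_sum A)
  rw [this]
  fun_prop

lemma continuous_gaussianWeight (J : Matrix (Fin d) (Fin d) ℝ) (x : EuclideanSpace ℝ (Fin d)) :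
    Continuous (gaussianWeight J x) := by
  unfold gaussianWeight
  fun_prop

lemma integrable_mul_gaussianWeight {J : Matrix (Fin d) (Fin d) ℝ} {c : ℝ} (hc : 0 < c)
    (hJ : ∀ h, c * ‖h‖ ^ 2 ≤ quadForm J h) (x : EuclideanSpace ℝ (Fin d))
    {f : EuclideanSpace ℝ (Fin d) → ℝ} (hf : Continuous f) (hfb : ∀ h, |f h| ≤ 1 + ‖h‖ ^ 2) :
    Integrable (fun h => f h * gaussianWeight J x h) := by
  obtain ⟨K, hK, hKb⟩ := exists_one_add_sq_mul_exp_le ‖x‖ (a := c / 2) (by positivity)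
  refine ((integrable_exp_neg_mul_sq_norm (d := d) (b := c / 2 / 2) (by positivity)).const_mul
    K).mono' (hf.mul (continuous_gaussianWeight J x)).aestronglyMeasurable
    (Eventually.of_forall fun h => ?_)
  rw [Real.norm_eq_abs, abs_mul, gaussianWeight, Real.abs_exp]
  refine le_trans ?_ (hKb ‖h‖)
  refine mul_le_mul (hfb h) (Real.exp_le_exp.2 ?_) (Real.exp_pos _).le (by positivity)
  nlinarith [hJ h, real_inner_le_norm h x]

lemma integral_gaussianWeight_pos {J : Matrix (Fin d) (Fin d) ℝ} {c : ℝ} (hc : 0 < c)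
    (hJ : ∀ h, c * ‖h‖ ^ 2 ≤ quadForm J h) (x : EuclideanSpace ℝ (Fin d)) :
    0 < ∫ h, gaussianWeight J x h := by
  have hi : Integrable (gaussianWeight J x) := by
    simpa using integrable_mul_gaussianWeight hc hJ x (f := fun _ => 1) continuous_const
      (by simp)
  exact integral_exp_pos hi

lemma hasLineDerivAt_gaussianWeight {J : Matrix (Fin d) (Fin d) ℝ} (hs : J.IsSymm)
    (x h : EuclideanSpace ℝ (Fin d)) (i : Fin d) :
    HasLineDerivAt ℝ (gaussianWeight J x) ((x i - ∑ l, J i l * h l) * gaussianWeight J x h) h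
      (EuclideanSpace.single i 1) := by
  have hq : ∀ t : ℝ, inner ℝ (h + t • EuclideanSpace.single i (1 : ℝ)) x -
      1 / 2 * quadForm J (h + t • EuclideanSpace.single i (1 : ℝ)) =
      (inner ℝ h x - 1 / 2 * quadForm J h) + t * (x i - ∑ l, J i l * h l) +
        t ^ 2 * (-(1 / 2) * J i i) := by
    intro t
    have h1 : inner ℝ (EuclideanSpace.single i (1 : ℝ)) x = x i := by
      simp [EuclideanSpace.inner_single_left]
    have h2 : quadForm J (h + t • EuclideanSpace.single i (1 : ℝ)) =
        quadForm J h + 2 * t * (∑ l, J i l * h l) + t ^ 2 * J i i := by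
      have e : (h + t • EuclideanSpace.single i (1 : ℝ)).ofLp = h.ofLp + t • Pi.single i 1 := by
        ext j; simp [Pi.single_apply]
      have e1 : h.ofLp ⬝ᵥ J.col i = ∑ l, J i l * h l := by
        simp only [dotProduct, col_apply]
        exact Finset.sum_congr rfl fun l _ => by rw [hs.apply l i]; ring
      have e2 : (J *ᵥ h.ofLp) i = ∑ l, J i l * h l := by simp [mulVec, dotProduct]
      unfold quadForm
      rw [e]
      simp only [mulVec_add, mulVec_smul, dotProduct_add, add_dotProduct, smul_dotProduct,
        dotProduct_smul, mulVec_single_one, single_one_dotProduct, e1, e2, col_apply, smul_eq_mul]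
      ring
    rw [inner_add_left, real_inner_smul_left, h1, h2]
    ring
  have hd : HasDerivAt (fun t : ℝ => (inner ℝ h x - 1 / 2 * quadForm J h) +
      t * (x i - ∑ l, J i l * h l) + t ^ 2 * (-(1 / 2) * J i i)) (x i - ∑ l, J i l * h l) 0 := by
    have := (((hasDerivAt_id (0 : ℝ)).mul_const (x i - ∑ l, J i l * h l)).const_add
      (inner ℝ h x - 1 / 2 * quadForm J h)).add
      ((hasDerivAt_pow 2 (0 : ℝ)).mul_const (-(1 / 2) * J i i))
    simpa [Pi.add_def] using this
  have := hd.exp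
  simp only [HasLineDerivAt, gaussianWeight, hq]
  convert! this using 1
  simp [mul_comm]

/-- Integration by parts of the Gaussian weight against a function with line derivative `f'`. -/
lemma integral_mul_score_gaussianWeight {J : Matrix (Fin d) (Fin d) ℝ} (hs : J.IsSymm) {c : ℝ}
    (hc : 0 < c) (hJ : ∀ h, c * ‖h‖ ^ 2 ≤ quadForm J h) (x : EuclideanSpace ℝ (Fin d)) (i : Fin d)
    {f : EuclideanSpace ℝ (Fin d) → ℝ} {f' : ℝ} (hf : Continuous f)
    (hf1 : ∀ h, |f h| ≤ 1 + ‖h‖ ^ 2) (hf2 : ∀ l h, |f h * h l| ≤ 1 + ‖h‖ ^ 2)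
    (hf' : ∀ h, HasLineDerivAt ℝ f f' h (EuclideanSpace.single i 1)) :
    ∑ l, J i l * ∫ h, f h * h l * gaussianWeight J x h =
      f' * (∫ h, gaussianWeight J x h) + x i * ∫ h, f h * gaussianWeight J x h := by
  have i0 : Integrable (gaussianWeight J x) := by
    simpa using integrable_mul_gaussianWeight hc hJ x (f := fun _ => 1) continuous_const
      (by simp)
  have i1 := integrable_mul_gaussianWeight hc hJ x hf hf1
  have i2 : ∀ l, Integrable (fun h => f h * h l * gaussianWeight J x h) := fun l =>
    integrable_mul_gaussianWeight hc hJ x (by fun_prop) (hf2 l)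
  have i3 : Integrable (fun h => ∑ l, J i l * (f h * h l * gaussianWeight J x h)) :=
    integrable_finsetSum _ fun l _ => (i2 l).const_mul _
  have e : (fun h => f h * ((x i - ∑ l, J i l * h l) * gaussianWeight J x h)) =
      fun h => x i * (f h * gaussianWeight J x h) -
        ∑ l, J i l * (f h * h l * gaussianWeight J x h) := by
    funext h
    have : ∑ l, J i l * (f h * h l * gaussianWeight J x h) =
        f h * (∑ l, J i l * h l) * gaussianWeight J x h := by
      rw [Finset.mul_sum, Finset.sum_mul]
      exact Finset.sum_congr rfl fun l _ => by ring
    rw [this]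
    ring
  have key := integral_bilinear_hasLineDerivAt_right_eq_neg_left_of_integrable
    (μ := (volume : Measure (EuclideanSpace ℝ (Fin d)))) (B := ContinuousLinearMap.mul ℝ ℝ)
    (f := f) (f' := fun _ => f') (g := gaussianWeight J x)
    (g' := fun h => (x i - ∑ l, J i l * h l) * gaussianWeight J x h)
    (v := EuclideanSpace.single i 1)
    (by simpa using i0.const_mul f')
    (by simpa [e, Pi.sub_def] using (i1.const_mul (x i)).sub i3)
    (by simpa using i1)
    (fun h _ => hf' h) (fun h _ => hasLineDerivAt_gaussianWeight hs x h i)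
  simp only [ContinuousLinearMap.mul_apply'] at key
  rw [e, integral_sub (i1.const_mul _) i3, integral_finsetSum _ fun l _ => (i2 l).const_mul _,
    integral_const_mul, integral_const_mul] at key
  simp only [integral_const_mul] at key
  linarith

lemma hasLineDerivAt_coord (h : EuclideanSpace ℝ (Fin d)) (i j : Fin d) :
    HasLineDerivAt ℝ (fun h : EuclideanSpace ℝ (Fin d) => h j)
      ((1 : Matrix (Fin d) (Fin d) ℝ) i j) h (EuclideanSpace.single i 1) := by
  have : HasDerivAt (fun t : ℝ => h j + t * (1 : Matrix (Fin d) (Fin d) ℝ) i j)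
      ((1 : Matrix (Fin d) (Fin d) ℝ) i j) 0 := by
    simpa using ((hasDerivAt_id (0 : ℝ)).mul_const _).const_add (h j)
  refine this.congr_of_eventuallyEq (Eventually.of_forall fun t => ?_)
  simp [Matrix.one_apply, eq_comm]

lemma abs_coord_mul_coord_le (h : EuclideanSpace ℝ (Fin d)) (i j : Fin d) :
    |h i * h j| ≤ 1 + ‖h‖ ^ 2 := by
  rw [abs_mul]
  nlinarith [abs_coord_le_norm h i, abs_coord_le_norm h j, abs_nonneg (h i), abs_nonneg (h j),
    norm_nonneg h]

lemma abs_coord_le (h : EuclideanSpace ℝ (Fin d)) (i : Fin d) : |h i| ≤ 1 + ‖h‖ ^ 2 := by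
  nlinarith [abs_coord_le_norm h i, sq_nonneg (‖h‖ - 1)]

/-- The normal equations for the first moments: `J m = x`. -/
lemma sum_mul_integral_coord_gaussianWeight {J : Matrix (Fin d) (Fin d) ℝ} (hs : J.IsSymm) {c : ℝ}
    (hc : 0 < c) (hJ : ∀ h, c * ‖h‖ ^ 2 ≤ quadForm J h) (x : EuclideanSpace ℝ (Fin d))
    (i : Fin d) :
    ∑ l, J i l * ∫ h, h l * gaussianWeight J x h = x i * ∫ h, gaussianWeight J x h := by
  have := integral_mul_score_gaussianWeight hs hc hJ x i (f := fun _ => 1) (f' := 0)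
    continuous_const (by simp) (fun l h => by simpa using abs_coord_le h l)
    (fun h => by simpa [HasLineDerivAt] using hasDerivAt_const (0 : ℝ) (1 : ℝ))
  simpa using this

/-- The normal equations for the second moments: `J E[h h'] = I + x E[h]'`. -/
lemma sum_mul_integral_coord_mul_coord_gaussianWeight {J : Matrix (Fin d) (Fin d) ℝ}
    (hs : J.IsSymm) {c : ℝ} (hc : 0 < c) (hJ : ∀ h, c * ‖h‖ ^ 2 ≤ quadForm J h)
    (x : EuclideanSpace ℝ (Fin d)) (i j : Fin d) :
    ∑ l, J i l * ∫ h, h l * h j * gaussianWeight J x h =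
      (1 : Matrix (Fin d) (Fin d) ℝ) i j * (∫ h, gaussianWeight J x h) +
        x i * ∫ h, h j * gaussianWeight J x h := by
  have := integral_mul_score_gaussianWeight hs hc hJ x i (f := fun h => h j)
    (by fun_prop) (fun h => abs_coord_le h j) (fun l h => abs_coord_mul_coord_le h j l)
    (fun h => hasLineDerivAt_coord h i j)
  simpa [mul_comm] using this

/-! ### Rescaling the quasi-posterior -/

/-- The quasi-posterior weight in the local parameter `h = s (θ - θ₀)`, normalized by its value
`exp (ℓ θ₀)` at `θ₀` and extended by zero outside of the parameter space. -/
noncomputable def localWeight (Θ : Set (EuclideanSpace ℝ (Fin d)))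
    (θ₀ : EuclideanSpace ℝ (Fin d)) (π ℓ : EuclideanSpace ℝ (Fin d) → ℝ) (s : ℝ)
    (h : EuclideanSpace ℝ (Fin d)) : ℝ :=
  Θ.indicator (fun θ => Real.exp (ℓ θ - ℓ θ₀) * π θ) (θ₀ + s⁻¹ • h)

section Rescaling

variable {Θ : Set (EuclideanSpace ℝ (Fin d))} {θ₀ : EuclideanSpace ℝ (Fin d)}
  {π ℓ : EuclideanSpace ℝ (Fin d) → ℝ}

lemma measurable_indicator_of_measurable_subtype {α : Type*} [MeasurableSpace α] {s : Set α}
    (hs : MeasurableSet s) {f : α → ℝ} (hf : Measurable fun x : s => f x) :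
    Measurable (s.indicator f) := by
  refine measurable_of_restrict_of_restrict_compl hs ?_ ?_
  · convert hf using 1
    funext x
    simp [Set.domRestrict]
  · convert (measurable_const : Measurable fun _ : (sᶜ : Set α) => (0 : ℝ)) using 1
    funext x
    have : (x : α) ∉ s := x.2
    simp [Set.domRestrict, this]

lemma measurable_localWeight (hΘ : IsCompact Θ) (hπ : ContinuousOn π Θ)
    (hℓ : Measurable fun θ : Θ => ℓ θ) (s : ℝ) : Measurable (localWeight Θ θ₀ π ℓ s) := by
  have h1 : Measurable fun θ : Θ => π θ := hπ.domRestrict.measurable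
  have h2 := measurable_indicator_of_measurable_subtype hΘ.isClosed.measurableSet
    (f := fun θ => Real.exp (ℓ θ - ℓ θ₀) * π θ) ((hℓ.sub_const _).exp.mul h1)
  exact h2.comp (by fun_prop)

lemma integral_indicator_comp_affine {Θ : Set (EuclideanSpace ℝ (Fin d))}
    (hΘ : MeasurableSet Θ) (θ₀ : EuclideanSpace ℝ (Fin d)) {s : ℝ} (hs : 0 < s)
    (F : EuclideanSpace ℝ (Fin d) → ℝ) :
    ∫ h, Θ.indicator F (θ₀ + s⁻¹ • h) = s ^ d * ∫ θ in Θ, F θ := by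
  rw [← integral_indicator hΘ, ← integral_add_left_eq_self (Θ.indicator F) θ₀,
    Measure.integral_comp_inv_smul_of_nonneg volume (fun h => Θ.indicator F (θ₀ + h)) hs.le]
  simp

lemma integral_mul_localWeight (hΘ : MeasurableSet Θ) {s : ℝ} (hs : 0 < s)
    (f : EuclideanSpace ℝ (Fin d) → ℝ) :
    ∫ h, f h * localWeight Θ θ₀ π ℓ s h =
      s ^ d * Real.exp (-ℓ θ₀) * ∫ θ in Θ, f (s • (θ - θ₀)) * (Real.exp (ℓ θ) * π θ) := by
  rw [mul_assoc, ← integral_const_mul, ← integral_indicator_comp_affine hΘ θ₀ hs]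
  refine integral_congr_ae (Eventually.of_forall fun h => ?_)
  simp only [localWeight, Set.indicator]
  split_ifs
  · rw [add_sub_cancel_left, smul_smul, mul_inv_cancel₀ hs.ne', one_smul, sub_eq_add_neg,
      Real.exp_add]
    ring
  · simp

/-- Quasi-posterior expectations are ratios of integrals against the local weight. -/
lemma integral_mul_quasiPosterior (hΘ : MeasurableSet Θ) {s : ℝ} (hs : 0 < s)
    (f : EuclideanSpace ℝ (Fin d) → ℝ) :
    ∫ θ in Θ, f (s • (θ - θ₀)) * quasiPosterior Θ π ℓ θ =
      (∫ h, f h * localWeight Θ θ₀ π ℓ s h) / ∫ h, localWeight Θ θ₀ π ℓ s h := by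
  have h1 := integral_mul_localWeight (Θ := Θ) (θ₀ := θ₀) (π := π) (ℓ := ℓ) hΘ hs fun _ => 1
  simp only [one_mul] at h1
  have h2 : s ^ d * Real.exp (-ℓ θ₀) ≠ 0 := by positivity
  rw [h1, integral_mul_localWeight hΘ hs, mul_div_mul_left _ _ h2, ← integral_div]
  simp only [quasiPosterior, mul_div_assoc]

lemma integrable_comp_affine_iff {s : ℝ} (hs : 0 < s)
    (F : EuclideanSpace ℝ (Fin d) → ℝ) :
    Integrable (fun h => F (θ₀ + s⁻¹ • h)) ↔ Integrable F := by
  rw [integrable_comp_smul_iff volume (fun h => F (θ₀ + h)) (inv_ne_zero hs.ne')]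
  refine ⟨fun h => ?_, fun h => h.comp_add_left θ₀⟩
  simpa using h.comp_add_left (-θ₀)

lemma integrableOn_mul_quasiPosterior (hΘ : MeasurableSet Θ) {s : ℝ} (hs : 0 < s)
    {f : EuclideanSpace ℝ (Fin d) → ℝ}
    (hf : Integrable fun h => f h * localWeight Θ θ₀ π ℓ s h) :
    IntegrableOn (fun θ => f (s • (θ - θ₀)) * quasiPosterior Θ π ℓ θ) Θ := by
  rw [← integrable_indicator_iff hΘ, ← integrable_comp_affine_iff (θ₀ := θ₀) hs]
  refine (hf.const_mul (Real.exp (ℓ θ₀) / ∫ t in Θ, Real.exp (ℓ t) * π t)).congr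
    (Eventually.of_forall fun h => ?_)
  simp only [localWeight, Set.indicator, quasiPosterior]
  split_ifs
  · simp only [add_sub_cancel_left, smul_smul, mul_inv_cancel₀ hs.ne', one_smul, Real.exp_sub]
    field_simp
  · simp

/-- The mean of the `i`-th local coordinate under the rescaled quasi-posterior. -/
noncomputable def localMean (Θ : Set (EuclideanSpace ℝ (Fin d)))
    (θ₀ : EuclideanSpace ℝ (Fin d)) (π ℓ : EuclideanSpace ℝ (Fin d) → ℝ) (s : ℝ)
    (i : Fin d) : ℝ :=
  (∫ h, h i * localWeight Θ θ₀ π ℓ s h) / ∫ h, localWeight Θ θ₀ π ℓ s h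

lemma quasiMean_apply (hΘ : MeasurableSet Θ) {s : ℝ} (hs : 0 < s)
    (hi0 : Integrable (localWeight Θ θ₀ π ℓ s)) (hpos : 0 < ∫ h, localWeight Θ θ₀ π ℓ s h)
    (hi1 : ∀ i, Integrable fun h => h i * localWeight Θ θ₀ π ℓ s h) (i : Fin d) :
    quasiMean Θ π ℓ i = θ₀ i + s⁻¹ * localMean Θ θ₀ π ℓ s i := by
  have e : ∀ j (θ : EuclideanSpace ℝ (Fin d)), θ j = θ₀ j + s⁻¹ * (s • (θ - θ₀)) j := by
    intro j θ
    simp only [PiLp.smul_apply, PiLp.sub_apply, smul_eq_mul]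
    field_simp
    ring
  have hi : ∀ j, Integrable fun h : EuclideanSpace ℝ (Fin d) =>
      (θ₀ j + s⁻¹ * h j) * localWeight Θ θ₀ π ℓ s h := fun j => by
    refine ((hi0.const_mul (θ₀ j)).add ((hi1 j).const_mul s⁻¹)).congr
      (Eventually.of_forall fun h => ?_)
    simp only [Pi.add_apply]
    ring
  have hint : ∀ j, IntegrableOn (fun θ => (quasiPosterior Θ π ℓ θ • θ) j) Θ := fun j => by
    refine (integrableOn_mul_quasiPosterior hΘ hs (hi j)).congr (Eventually.of_forall fun θ => ?_)
    show (θ₀ j + s⁻¹ * (s • (θ - θ₀)) j) * quasiPosterior Θ π ℓ θ = quasiPosterior Θ π ℓ θ * θ j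
    rw [← e j θ, mul_comm]
  rw [quasiMean, eval_integral_piLp hint]
  calc ∫ θ in Θ, (quasiPosterior Θ π ℓ θ • θ) i
      = ∫ θ in Θ, (θ₀ i + s⁻¹ * (s • (θ - θ₀)) i) * quasiPosterior Θ π ℓ θ := by
        refine integral_congr_ae (Eventually.of_forall fun θ => ?_)
        simp only [PiLp.smul_apply, smul_eq_mul]
        rw [show θ i = θ₀ i + s⁻¹ * (s * (θ - θ₀) i) from e i θ]
        ring_nf
    _ = _ := by
        rw [integral_mul_quasiPosterior hΘ hs (fun h => θ₀ i + s⁻¹ * h i), localMean]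
        simp only [add_mul, mul_assoc]
        rw [integral_add (hi0.const_mul _) ((hi1 i).const_mul _), integral_const_mul,
          integral_const_mul]
        field_simp

lemma scaledQuasiCov_apply (hΘ : MeasurableSet Θ) {n : ℕ} (hn : 1 ≤ n)
    (hi0 : Integrable (localWeight Θ θ₀ π ℓ (Real.sqrt n)))
    (hpos : 0 < ∫ h, localWeight Θ θ₀ π ℓ (Real.sqrt n) h)
    (hi1 : ∀ i, Integrable fun h => h i * localWeight Θ θ₀ π ℓ (Real.sqrt n) h)
    (hi2 : ∀ i j, Integrable fun h => h i * h j * localWeight Θ θ₀ π ℓ (Real.sqrt n) h)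
    (i j : Fin d) :
    scaledQuasiCov Θ π ℓ n i j =
      (∫ h, h i * h j * localWeight Θ θ₀ π ℓ (Real.sqrt n) h) /
        (∫ h, localWeight Θ θ₀ π ℓ (Real.sqrt n) h) -
      localMean Θ θ₀ π ℓ (Real.sqrt n) i * localMean Θ θ₀ π ℓ (Real.sqrt n) j := by
  set s := Real.sqrt n with hsdef
  have hs : 0 < s := Real.sqrt_pos.2 (by exact_mod_cast hn)
  have hsn : (n : ℝ) = s ^ 2 := (Real.sq_sqrt (Nat.cast_nonneg n)).symm
  have hm := quasiMean_apply hΘ hs hi0 hpos hi1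
  set m := localMean Θ θ₀ π ℓ s with hmdef
  have e : ∀ θ : EuclideanSpace ℝ (Fin d),
      (n : ℝ) * ((θ i - quasiMean Θ π ℓ i) * (θ j - quasiMean Θ π ℓ j)) =
        ((s • (θ - θ₀)) i - m i) * ((s • (θ - θ₀)) j - m j) := by
    intro θ
    rw [hm, hm, hsn]
    simp only [PiLp.smul_apply, PiLp.sub_apply, smul_eq_mul]
    field_simp
    ring
  simp only [scaledQuasiCov, Matrix.of_apply, e]
  rw [integral_mul_quasiPosterior hΘ hs (fun h => (h i - m i) * (h j - m j))]
  have e2 : (fun h : EuclideanSpace ℝ (Fin d) =>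
      (h i - m i) * (h j - m j) * localWeight Θ θ₀ π ℓ s h) = fun h =>
      h i * h j * localWeight Θ θ₀ π ℓ s h - m j * (h i * localWeight Θ θ₀ π ℓ s h) -
        m i * (h j * localWeight Θ θ₀ π ℓ s h) + m i * m j * localWeight Θ θ₀ π ℓ s h := by
    funext h
    ring
  have hI : ∀ i, ∫ h, h i * localWeight Θ θ₀ π ℓ s h =
      m i * ∫ h, localWeight Θ θ₀ π ℓ s h := fun i => by
    rw [hmdef, localMean, div_mul_cancel₀ _ hpos.ne']
  have i1 : Integrable fun h : EuclideanSpace ℝ (Fin d) =>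
      h i * h j * localWeight Θ θ₀ π ℓ s h - m j * (h i * localWeight Θ θ₀ π ℓ s h) :=
    (hi2 i j).sub ((hi1 i).const_mul _)
  have i2 : Integrable fun h : EuclideanSpace ℝ (Fin d) =>
      h i * h j * localWeight Θ θ₀ π ℓ s h - m j * (h i * localWeight Θ θ₀ π ℓ s h) -
        m i * (h j * localWeight Θ θ₀ π ℓ s h) := i1.sub ((hi1 j).const_mul _)
  rw [e2, integral_add i2 (hi0.const_mul _), integral_sub i1 ((hi1 j).const_mul _), integral_sub (hi2 i j) ((hi1 i).const_mul _), integral_const_mul, integral_const_mul,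
    integral_const_mul, hI, hI]
  field_simp
  ring

end Rescaling

/-! ### Laplace approximation along a deterministic sequence -/

/-- Asymptotic quadratic behaviour of a deterministic sequence of criterion functions `ℓ k` at
scale `s k → ∞`: in the local parameter `h = s k (θ - θ₀)`, the criterion is
`h' x k - h' J k h / 2` up to `ε (1 + |h|²)` near `θ₀`, it is of order `- s k ²` away from `θ₀`, and
the score `x k` and the curvature `J k` converge. -/
structure QuadraticAlong (Θ : Set (EuclideanSpace ℝ (Fin d))) (θ₀ : EuclideanSpace ℝ (Fin d))
    (s : ℕ → ℝ) (ℓ : ℕ → EuclideanSpace ℝ (Fin d) → ℝ) (J : ℕ → Matrix (Fin d) (Fin d) ℝ)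
    (x : ℕ → EuclideanSpace ℝ (Fin d)) (J₀ : Matrix (Fin d) (Fin d) ℝ)
    (x₀ : EuclideanSpace ℝ (Fin d)) : Prop where
  measurable : ∀ k, Measurable fun θ : Θ => ℓ k θ
  scale : Tendsto s atTop atTop
  expansion : ∀ ε > 0, ∃ δ > 0, ∀ᶠ k in atTop, ∀ θ ∈ Θ, ‖θ - θ₀‖ ≤ δ →
    |ℓ k θ - ℓ k θ₀ - (inner ℝ (s k • (θ - θ₀)) (x k) - 1 / 2 * quadForm (J k) (s k • (θ - θ₀)))| ≤
      ε * (1 + ‖s k • (θ - θ₀)‖ ^ 2)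
  separation : ∀ δ > 0, ∃ ε > 0, ∀ᶠ k in atTop, ∀ θ ∈ Θ, δ ≤ ‖θ - θ₀‖ →
    ℓ k θ - ℓ k θ₀ ≤ -(ε * s k ^ 2)
  curvature_pos : ∃ c > 0, ∀ᶠ k in atTop, ∀ h, c * ‖h‖ ^ 2 ≤ quadForm (J k) h
  curvature_symm : ∀ᶠ k in atTop, (J k).IsSymm
  tendsto_curvature : Tendsto J atTop (𝓝 J₀)
  tendsto_score : Tendsto x atTop (𝓝 x₀)

lemma tendsto_quadForm {ι : Type*} {l : Filter ι} {A : ι → Matrix (Fin d) (Fin d) ℝ}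
    {A₀ : Matrix (Fin d) (Fin d) ℝ} {x : ι → EuclideanSpace ℝ (Fin d)}
    {x₀ : EuclideanSpace ℝ (Fin d)} (hA : Tendsto A l (𝓝 A₀)) (hx : Tendsto x l (𝓝 x₀)) :
    Tendsto (fun k => quadForm (A k) (x k)) l (𝓝 (quadForm A₀ x₀)) := by
  have h : Continuous fun p : Matrix (Fin d) (Fin d) ℝ × EuclideanSpace ℝ (Fin d) =>
      quadForm p.1 p.2 := by
    simp only [quadForm_eq_sum]
    fun_prop
  exact (h.tendsto (A₀, x₀)).comp (hA.prodMk_nhds hx)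

section Laplace

variable {Θ : Set (EuclideanSpace ℝ (Fin d))} {θ₀ : EuclideanSpace ℝ (Fin d)}
  {π : EuclideanSpace ℝ (Fin d) → ℝ}
  {s : ℕ → ℝ} {ℓ : ℕ → EuclideanSpace ℝ (Fin d) → ℝ} {J : ℕ → Matrix (Fin d) (Fin d) ℝ}
  {x : ℕ → EuclideanSpace ℝ (Fin d)} {J₀ : Matrix (Fin d) (Fin d) ℝ}
  {x₀ : EuclideanSpace ℝ (Fin d)}

lemma QuadraticAlong.limit_curvature_pos (H : QuadraticAlong Θ θ₀ s ℓ J x J₀ x₀) :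
    ∃ c > 0, ∀ h, c * ‖h‖ ^ 2 ≤ quadForm J₀ h := by
  obtain ⟨c, hc, hJ⟩ := H.curvature_pos
  exact ⟨c, hc, fun h => ge_of_tendsto (tendsto_quadForm H.tendsto_curvature tendsto_const_nhds)
    (hJ.mono fun k hk => hk h)⟩

lemma QuadraticAlong.limit_curvature_symm (H : QuadraticAlong Θ θ₀ s ℓ J x J₀ x₀) :
    J₀.IsSymm :=
  tendsto_nhds_unique_of_eventuallyEq
    ((Continuous.matrix_transpose continuous_id).tendsto J₀ |>.comp H.tendsto_curvature)
    H.tendsto_curvature (H.curvature_symm.mono fun _ hk => hk)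

/-- The local weight converges pointwise to the Gaussian weight. -/
lemma QuadraticAlong.tendsto_localWeight (H : QuadraticAlong Θ θ₀ s ℓ J x J₀ x₀)
    (hΘ : Θ ∈ 𝓝 θ₀) (hπ : ContinuousOn π Θ) (h : EuclideanSpace ℝ (Fin d)) :
    Tendsto (fun k => localWeight Θ θ₀ π (ℓ k) (s k) h) atTop
      (𝓝 (π θ₀ * gaussianWeight J₀ x₀ h)) := by
  have hθ : Tendsto (fun k => θ₀ + (s k)⁻¹ • h) atTop (𝓝 θ₀) := by
    simpa using tendsto_const_nhds.add (H.scale.inv_tendsto_atTop.smul_const h)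
  have hpos : ∀ᶠ k in atTop, 0 < s k := H.scale.eventually_gt_atTop 0
  have hR : Tendsto (fun k => ℓ k (θ₀ + (s k)⁻¹ • h) - ℓ k θ₀ -
      (inner ℝ h (x k) - 1 / 2 * quadForm (J k) h)) atTop (𝓝 0) := by
    rw [Metric.tendsto_nhds]
    intro ε hε
    obtain ⟨δ, hδ, hexp⟩ := H.expansion (ε / (2 * (1 + ‖h‖ ^ 2))) (by positivity)
    filter_upwards [hexp, hpos, hθ.eventually hΘ, hθ.eventually (Metric.closedBall_mem_nhds θ₀ hδ)]
      with k hk hs hmem hball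
    have := hk _ hmem (by simpa [dist_eq_norm] using hball)
    simp only [add_sub_cancel_left, smul_smul, mul_inv_cancel₀ hs.ne', one_smul] at this
    rw [Real.dist_eq, sub_zero]
    refine this.trans_lt ?_
    rw [div_mul_eq_mul_div, div_lt_iff₀ (by positivity)]
    nlinarith [sq_nonneg ‖h‖]
  have hL : Tendsto (fun k => ℓ k (θ₀ + (s k)⁻¹ • h) - ℓ k θ₀) atTop
      (𝓝 (inner ℝ h x₀ - 1 / 2 * quadForm J₀ h)) := by
    have h1 : Tendsto (fun k => inner ℝ h (x k) - 1 / 2 * quadForm (J k) h) atTop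
        (𝓝 (inner ℝ h x₀ - 1 / 2 * quadForm J₀ h)) :=
      (tendsto_const_nhds.inner H.tendsto_score).sub
        ((tendsto_quadForm H.tendsto_curvature tendsto_const_nhds).const_mul _)
    simpa using hR.add h1
  have hP : Tendsto (fun k => π (θ₀ + (s k)⁻¹ • h)) atTop (𝓝 (π θ₀)) :=
    ((hπ.continuousAt hΘ).tendsto).comp hθ
  have := ((Real.continuous_exp.tendsto _).comp hL).mul hP
  rw [gaussianWeight, mul_comm]
  refine this.congr' ?_
  filter_upwards [hθ.eventually hΘ] with k hk
  have hk' : θ₀ + (s k)⁻¹ • h ∈ Θ := hk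
  simp [localWeight, hk']

/-- The local weights have a common Gaussian tail: near `θ₀` by the quadratic expansion, and
away from `θ₀` because there `|h|² ≤ s² D²` with `D` a bound for the parameter space. -/
lemma QuadraticAlong.exists_localWeight_le (H : QuadraticAlong Θ θ₀ s ℓ J x J₀ x₀)
    (hΘ : IsCompact Θ) (hπ : ContinuousOn π Θ) :
    ∃ K b : ℝ, 0 < b ∧ ∀ᶠ k in atTop, ∀ h,
      (1 + ‖h‖ ^ 2) * |localWeight Θ θ₀ π (ℓ k) (s k) h| ≤ K * Real.exp (-(b * ‖h‖ ^ 2)) := by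
  obtain ⟨c, hc, hJ⟩ := H.curvature_pos
  obtain ⟨δ, hδ, hexp⟩ := H.expansion (c / 4) (by positivity)
  obtain ⟨e, he, hsep⟩ := H.separation δ hδ
  obtain ⟨B, hB⟩ := hΘ.exists_bound_of_continuousOn hπ
  obtain ⟨D, hD0, hD⟩ : ∃ D > 0, ∀ θ ∈ Θ, ‖θ - θ₀‖ ≤ D := by
    obtain ⟨D, hD⟩ := hΘ.exists_bound_of_continuousOn (f := fun θ => θ - θ₀) (by fun_prop)
    exact ⟨max D 1, by positivity, fun θ hθ => (hD θ hθ).trans (le_max_left _ _)⟩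
  obtain ⟨M, hM0, hM⟩ : ∃ M > 0, ∀ᶠ k in atTop, ‖x k‖ ≤ M :=
    ⟨‖x₀‖ + 1, by positivity,
      (H.tendsto_score.norm.eventually_lt_const (lt_add_one _)).mono fun _ h => h.le⟩
  -- `c / 4` is the decay left near `θ₀`, `e / D ^ 2` the one away from it
  set a := min (c / 4) (e / D ^ 2) with ha
  have ha0 : 0 < a := by positivity
  obtain ⟨K, hK, hKb⟩ := exists_one_add_sq_mul_exp_le M ha0
  refine ⟨|B| * Real.exp (c / 4) * K, a / 2, by positivity, ?_⟩
  filter_upwards [hJ, hexp, hsep, hM, H.scale.eventually_gt_atTop 0] with k hJ hexp hsep hM hs h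
  by_cases hmem : θ₀ + (s k)⁻¹ • h ∈ Θ
  swap
  · simp only [localWeight, hmem, not_false_iff, Set.indicator_of_notMem, abs_zero, mul_zero]
    positivity
  have hle : ℓ k (θ₀ + (s k)⁻¹ • h) - ℓ k θ₀ ≤ c / 4 + (M * ‖h‖ - a * ‖h‖ ^ 2) := by
    rcases le_total ‖(s k)⁻¹ • h‖ δ with hn | hf
    · have h1 := hexp _ hmem (by simpa using hn)
      simp only [add_sub_cancel_left, smul_smul, mul_inv_cancel₀ hs.ne', one_smul] at h1
      have h2 := (abs_le.1 h1).2
      have h3 : inner ℝ h (x k) ≤ M * ‖h‖ :=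
        (real_inner_le_norm _ _).trans (by nlinarith [norm_nonneg h])
      have h4 : a * ‖h‖ ^ 2 ≤ c / 4 * ‖h‖ ^ 2 := by gcongr; exact min_le_left _ _
      linarith [hJ h]
    · have h1 := hsep _ hmem (by simpa using hf)
      have h2 : ‖h‖ ≤ D * s k := by
        have := hD _ hmem
        rw [add_sub_cancel_left, norm_smul, norm_inv, Real.norm_eq_abs, abs_of_pos hs,
          inv_mul_le_iff₀ hs] at this
        linarith
      have h3 : a * ‖h‖ ^ 2 ≤ e * s k ^ 2 := by
        calc a * ‖h‖ ^ 2 ≤ e / D ^ 2 * (D * s k) ^ 2 := by gcongr; exact min_le_right _ _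
          _ = e * s k ^ 2 := by field_simp
      have : 0 ≤ M * ‖h‖ := by positivity
      linarith
  have hπB : |π (θ₀ + (s k)⁻¹ • h)| ≤ |B| := (hB _ hmem).trans (le_abs_self B)
  rw [localWeight, Set.indicator_of_mem hmem, abs_mul, Real.abs_exp]
  calc (1 + ‖h‖ ^ 2) * (Real.exp (ℓ k (θ₀ + (s k)⁻¹ • h) - ℓ k θ₀) * |π (θ₀ + (s k)⁻¹ • h)|)
      ≤ (1 + ‖h‖ ^ 2) * (Real.exp (c / 4 + (M * ‖h‖ - a * ‖h‖ ^ 2)) * |B|) := by gcongr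
    _ = |B| * Real.exp (c / 4) * ((1 + ‖h‖ ^ 2) * Real.exp (M * ‖h‖ - a * ‖h‖ ^ 2)) := by
        rw [Real.exp_add]; ring
    _ ≤ |B| * Real.exp (c / 4) * (K * Real.exp (-(a / 2 * ‖h‖ ^ 2))) := by
        exact mul_le_mul_of_nonneg_left (hKb _) (by positivity)
    _ = _ := by ring

lemma QuadraticAlong.eventually_integrable_and_tendsto (H : QuadraticAlong Θ θ₀ s ℓ J x J₀ x₀)
    (hΘ : IsCompact Θ) (hΘ₀ : Θ ∈ 𝓝 θ₀) (hπ : ContinuousOn π Θ)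
    {f : EuclideanSpace ℝ (Fin d) → ℝ} (hf : Continuous f) (hfb : ∀ h, |f h| ≤ 1 + ‖h‖ ^ 2) :
    (∀ᶠ k in atTop, Integrable fun h => f h * localWeight Θ θ₀ π (ℓ k) (s k) h) ∧
      Tendsto (fun k => ∫ h, f h * localWeight Θ θ₀ π (ℓ k) (s k) h) atTop
        (𝓝 (π θ₀ * ∫ h, f h * gaussianWeight J₀ x₀ h)) := by
  obtain ⟨K, b, hb, hK⟩ := H.exists_localWeight_le hΘ hπ
  have hm : ∀ k, AEStronglyMeasurable
      (fun h => f h * localWeight Θ θ₀ π (ℓ k) (s k) h) volume := fun k =>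
    (hf.measurable.mul (measurable_localWeight hΘ hπ (H.measurable k) _)).aestronglyMeasurable
  have hbd : ∀ᶠ k in atTop, ∀ᵐ h, ‖f h * localWeight Θ θ₀ π (ℓ k) (s k) h‖ ≤
      K * Real.exp (-(b * ‖h‖ ^ 2)) := hK.mono fun k hk => Eventually.of_forall fun h => by
    rw [Real.norm_eq_abs, abs_mul]
    exact (mul_le_mul_of_nonneg_right (hfb h) (abs_nonneg _)).trans (hk h)
  have hi := (integrable_exp_neg_mul_sq_norm (d := d) hb).const_mul K
  refine ⟨hbd.mono fun k hk => hi.mono' (hm k) hk, ?_⟩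
  rw [← integral_const_mul]
  refine tendsto_integral_filter_of_dominated_convergence _ (Eventually.of_forall hm) hbd hi
    (Eventually.of_forall fun h => ?_)
  have := (H.tendsto_localWeight hΘ₀ hπ h).const_mul (f h)
  convert this using 2
  ring

/-- The mean and the scaled covariance of the quasi-posterior converge to those of the Gaussian
`N(J₀⁻¹ x₀, J₀⁻¹)`. -/
theorem QuadraticAlong.tendsto_quasiMean_and_scaledQuasiCov {N : ℕ → ℕ}
    (H : QuadraticAlong Θ θ₀ (fun k => Real.sqrt (N k)) ℓ J x J₀ x₀)
    (hΘ : IsCompact Θ) (hΘ₀ : Θ ∈ 𝓝 θ₀) (hπ : ContinuousOn π Θ) (hπ₀ : 0 < π θ₀) :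
    Tendsto (fun k => Real.sqrt (N k) • (quasiMean Θ π (ℓ k) - θ₀)) atTop
        (𝓝 (WithLp.toLp 2 (J₀⁻¹ *ᵥ x₀.ofLp))) ∧
      Tendsto (fun k => scaledQuasiCov Θ π (ℓ k) (N k)) atTop (𝓝 J₀⁻¹) := by
  obtain ⟨c, hc, hJ⟩ := H.limit_curvature_pos
  have hsymm := H.limit_curvature_symm
  set Z := ∫ h, gaussianWeight J₀ x₀ h with hZ
  have hZ0 : 0 < Z := integral_gaussianWeight_pos hc hJ x₀
  set m : Fin d → ℝ := fun i => (∫ h, h i * gaussianWeight J₀ x₀ h) / Z with hm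
  set V : Matrix (Fin d) (Fin d) ℝ := Matrix.of fun i j =>
    (∫ h, h i * h j * gaussianWeight J₀ x₀ h) / Z - m i * m j with hV
  have e1 : J₀ *ᵥ m = x₀.ofLp := by
    ext i
    have := sum_mul_integral_coord_gaussianWeight hsymm hc hJ x₀ i
    simp only [mulVec, dotProduct, hm, ← mul_div_assoc, ← Finset.sum_div]
    rw [this, mul_div_cancel_right₀ _ hZ0.ne']
  have e2 : J₀ * V = 1 := by
    ext i j
    have h1 := sum_mul_integral_coord_mul_coord_gaussianWeight hsymm hc hJ x₀ i j
    have h2 := sum_mul_integral_coord_gaussianWeight hsymm hc hJ x₀ i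
    have h3 : ∑ l, J₀ i l * (m l * m j) = x₀ i * m j := by
      rw [← congrFun e1 i]
      simp only [mulVec, dotProduct, Finset.sum_mul, mul_assoc]
    simp only [Matrix.mul_apply, hV, Matrix.of_apply, mul_sub, Finset.sum_sub_distrib, h3,
      ← mul_div_assoc, ← Finset.sum_div, h1]
    simp only [hm, ← hZ]
    field_simp
    ring
  have hinv : J₀⁻¹ = V := Matrix.inv_eq_right_inv e2
  have hm' : J₀⁻¹ *ᵥ x₀.ofLp = m := by
    rw [← e1, mulVec_mulVec, hinv, mul_eq_one_comm.1 e2, one_mulVec]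
  have T0 := H.eventually_integrable_and_tendsto hΘ hΘ₀ hπ (f := fun _ => 1) continuous_const
    (by simp)
  simp only [one_mul] at T0
  have T1 := fun i => H.eventually_integrable_and_tendsto hΘ hΘ₀ hπ (f := fun h => h i)
    (by fun_prop) (fun h => abs_coord_le h i)
  have T2 := fun i j => H.eventually_integrable_and_tendsto hΘ hΘ₀ hπ (f := fun h => h i * h j)
    (by fun_prop) (fun h => abs_coord_mul_coord_le h i j)
  have hne : π θ₀ * Z ≠ 0 := (mul_pos hπ₀ hZ0).ne'
  have L1 : ∀ i, Tendsto (fun k => localMean Θ θ₀ π (ℓ k) (Real.sqrt (N k)) i) atTop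
      (𝓝 (m i)) := fun i => by
    have := (T1 i).2.div T0.2 hne
    rwa [mul_div_mul_left _ _ hπ₀.ne'] at this
  have hpos : ∀ᶠ k in atTop, 0 < ∫ h, localWeight Θ θ₀ π (ℓ k) (Real.sqrt (N k)) h :=
    T0.2.eventually_const_lt (mul_pos hπ₀ hZ0)
  have hi1 : ∀ᶠ k in atTop, ∀ i,
      Integrable fun h => h i * localWeight Θ θ₀ π (ℓ k) (Real.sqrt (N k)) h :=
    eventually_all.2 fun i => (T1 i).1
  have hi2 : ∀ᶠ k in atTop, ∀ i j,
      Integrable fun h => h i * h j * localWeight Θ θ₀ π (ℓ k) (Real.sqrt (N k)) h :=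
    eventually_all.2 fun i => eventually_all.2 fun j => (T2 i j).1
  have hmeas := hΘ.isClosed.measurableSet
  have hs := H.scale.eventually_gt_atTop 0
  constructor
  · have hp : Tendsto (fun k => (WithLp.toLp 2 (localMean Θ θ₀ π (ℓ k) (Real.sqrt (N k))) :
        EuclideanSpace ℝ (Fin d))) atTop (𝓝 (WithLp.toLp 2 m)) :=
      ((PiLp.continuous_toLp 2 _).tendsto m).comp (tendsto_pi_nhds.2 L1)
    rw [hm']
    refine hp.congr' ?_
    filter_upwards [T0.1, hpos, hi1, hs] with k h0 hp h1 hs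
    ext i
    simp only [PiLp.smul_apply, PiLp.sub_apply, smul_eq_mul, quasiMean_apply hmeas hs h0 hp h1]
    field_simp
    ring
  · rw [hinv]
    refine tendsto_pi_nhds.2 fun i => tendsto_pi_nhds.2 fun j => ?_
    have := ((T2 i j).2.div T0.2 hne).sub ((L1 i).mul (L1 j))
    rw [mul_div_mul_left _ _ hπ₀.ne'] at this
    refine this.congr' ?_
    filter_upwards [T0.1, hpos, hi1, hi2, hs] with k h0 hp h1 h2 hs
    have hn : 1 ≤ N k := by
      have := Real.sqrt_pos.1 hs
      exact_mod_cast this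
    exact (scaledQuasiCov_apply hmeas hn h0 hp h1 h2 i j).symm

end Laplace

/-! ### Uniformly positive definite matrices -/

lemma abs_entry_inv_le {A : Matrix (Fin d) (Fin d) ℝ} (hA : IsUnit A) {c : ℝ} (hc : 0 < c)
    (hpos : ∀ x, c * ‖x‖ ^ 2 ≤ quadForm A x) (i j : Fin d) : |A⁻¹ i j| ≤ c⁻¹ := by
  set y : EuclideanSpace ℝ (Fin d) := WithLp.toLp 2 (A⁻¹ *ᵥ Pi.single j 1) with hy
  have h1 : quadForm A y = y j := by
    simp only [quadForm, hy, mulVec_mulVec]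
    rw [mul_nonsing_inv _ ((isUnit_iff_isUnit_det A).1 hA), one_mulVec, dotProduct_single_one]
  have h2 := hpos y
  have h3 := abs_coord_le_norm y j
  have h4 : ‖y‖ ≤ c⁻¹ := by
    rcases (norm_nonneg y).eq_or_lt with h0 | h0
    · rw [← h0]; positivity
    · rw [← one_div, le_div_iff₀ hc]
      have : c * ‖y‖ ^ 2 ≤ ‖y‖ := h2.trans (h1.le.trans ((le_abs_self _).trans h3))
      nlinarith
  have h5 : A⁻¹ i j = y i := by simp [hy]
  rw [h5]
  exact (abs_coord_le_norm y i).trans h4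

lemma posDef_of_quadForm {A : Matrix (Fin d) (Fin d) ℝ} (hs : A.IsSymm) {c : ℝ} (hc : 0 < c)
    (hpos : ∀ x, c * ‖x‖ ^ 2 ≤ quadForm A x) : A.PosDef := by
  refine Matrix.PosDef.of_dotProduct_mulVec_pos (by simpa [IsHermitian, IsSymm] using hs) fun x hx => ?_
  have hx' : (WithLp.toLp 2 x : EuclideanSpace ℝ (Fin d)) ≠ 0 := by simpa using hx
  have h := hpos (WithLp.toLp 2 x)
  have h0 : 0 < ‖(WithLp.toLp 2 x : EuclideanSpace ℝ (Fin d))‖ := norm_pos_iff.2 hx'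
  exact (by positivity : 0 < c * ‖(WithLp.toLp 2 x : EuclideanSpace ℝ (Fin d))‖ ^ 2).trans_le
    (by simpa [quadForm] using h)

lemma sqrt_inv_mul_self {A : Matrix (Fin d) (Fin d) ℝ} (hA : A.PosDef) :
    CFC.sqrt A⁻¹ * CFC.sqrt A⁻¹ = A⁻¹ :=
  CFC.sqrt_mul_sqrt_self _ hA.inv.posSemidef.nonneg

lemma isSymm_sqrt (A : Matrix (Fin d) (Fin d) ℝ) : (CFC.sqrt A).IsSymm := by
  have h : (CFC.sqrt A).PosSemidef := nonneg_iff_posSemidef.1 (CFC.sqrt_nonneg A)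
  simpa [IsHermitian, IsSymm] using h.1

lemma abs_entry_le_of_mul_self {B : Matrix (Fin d) (Fin d) ℝ} (hB : B.IsSymm) {K : ℝ}
    (h : ∀ i, (B * B) i i ≤ K) (i j : Fin d) : |B i j| ≤ Real.sqrt K := by
  refine Real.abs_le_sqrt (le_trans ?_ (h i))
  rw [Matrix.mul_apply]
  refine le_trans (by rw [hB.apply i j, sq])
    (Finset.single_le_sum (f := fun l => B i l * B l i) (fun l _ => ?_) (Finset.mem_univ j))
  rw [hB.apply i l]
  exact mul_self_nonneg _

/-- The matrices all of whose entries are at most `K` in absolute value. -/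
def boundedMatrices (d : ℕ) (K : ℝ) : Set (Matrix (Fin d) (Fin d) ℝ) :=
  {A | ∀ i j, |A i j| ≤ K}

lemma isCompact_boundedMatrices (d : ℕ) (K : ℝ) : IsCompact (boundedMatrices d K) := by
  have h : IsCompact (Set.univ.pi fun _ : Fin d => Set.univ.pi fun _ : Fin d => Set.Icc (-K) K) :=
    isCompact_univ_pi fun _ => isCompact_univ_pi fun _ => isCompact_Icc
  refine h.of_isClosed_subset ?_ fun A hA i _ j _ => abs_le.1 (hA i j)
  simp only [boundedMatrices, Set.ofPred_forall]
  exact isClosed_iInter fun i => isClosed_iInter fun j =>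
    isClosed_le (by fun_prop) continuous_const

/-- Along a subsequence, two bounded and uniformly positive definite sequences of matrices converge,
together with the inverse square roots of the second one. -/
lemma exists_subseq_matrices {J Om : ℕ → Matrix (Fin d) (Fin d) ℝ}
    (hJ : BoundedUniformlyPosDef J) (hOm : BoundedUniformlyPosDef Om) {N : ℕ → ℕ}
    (hN : Tendsto N atTop atTop) :
    ∃ φ : ℕ → ℕ, StrictMono φ ∧ ∃ J₀ Om₀ S₀ : Matrix (Fin d) (Fin d) ℝ,
      Tendsto (fun k => J (N (φ k))) atTop (𝓝 J₀) ∧ Tendsto (fun k => Om (N (φ k))) atTop (𝓝 Om₀) ∧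
      Tendsto (fun k => CFC.sqrt (Om (N (φ k)))⁻¹) atTop (𝓝 S₀) := by
  obtain ⟨C, hC⟩ := hJ.bounded
  obtain ⟨C', hC'⟩ := hOm.bounded
  obtain ⟨c, hc, hpos⟩ := hOm.uniformly_pos
  have hcomp := (isCompact_boundedMatrices d C).prod ((isCompact_boundedMatrices d C').prod
    (isCompact_boundedMatrices d (Real.sqrt c⁻¹)))
  have : FirstCountableTopology (Matrix (Fin d) (Fin d) ℝ) :=
    inferInstanceAs (FirstCountableTopology (Fin d → Fin d → ℝ))
  obtain ⟨⟨J₀, Om₀, S₀⟩, -, φ, hφ, hlim⟩ := hcomp.tendsto_subseq'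
    (x := fun k => (J (N k), Om (N k), CFC.sqrt (Om (N k))⁻¹)) (by
      refine Eventually.frequently ?_
      filter_upwards [hN.eventually_ge_atTop 1] with k hk
      have hpd := posDef_of_quadForm (hOm.isSymm _ hk) hc (hpos _ hk)
      refine ⟨hC _ hk, hC' _ hk, abs_entry_le_of_mul_self (isSymm_sqrt _) fun i => ?_⟩
      rw [sqrt_inv_mul_self hpd]
      exact (le_abs_self _).trans (abs_entry_inv_le hpd.isUnit hc (hpos _ hk) i i))
  exact ⟨φ, hφ, J₀, Om₀, S₀, hlim.fst_nhds, hlim.snd_nhds.fst_nhds, hlim.snd_nhds.snd_nhds⟩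

/-! ### Events of high probability -/

section Events

variable {S : Type*} [MeasurableSpace S] {P : Measure S}
  {Θ : Set (EuclideanSpace ℝ (Fin d))} {θ₀ : EuclideanSpace ℝ (Fin d)}
  {L : ℕ → EuclideanSpace ℝ (Fin d) → S → ℝ} {Δ : ℕ → S → EuclideanSpace ℝ (Fin d)}
  {J Om : ℕ → Matrix (Fin d) (Fin d) ℝ}

/-- The standardized score `Om_n^{-1/2} Δ_n / √n`. -/
noncomputable def stdScore (Om : ℕ → Matrix (Fin d) (Fin d) ℝ)
    (Δ : ℕ → S → EuclideanSpace ℝ (Fin d)) (n : ℕ) (ω : S) : EuclideanSpace ℝ (Fin d) :=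
  Matrix.toEuclideanCLM (𝕜 := ℝ) (CFC.sqrt (Om n)⁻¹) ((Real.sqrt n)⁻¹ • Δ n ω)

/-- The two remainder bounds combine into one on a fixed neighbourhood of `θ₀`, in which the
radius `M` separating the two regimes no longer occurs. -/
lemma exists_remainder_le [IsProbabilityMeasure P] (hExp : ExpansionAssumption P Θ θ₀ L Δ J Om) {ε : ℝ} (hε : 0 < ε)
    {e : ℝ≥0∞} (he : 0 < e) :
    ∃ δ > 0, ∀ᶠ n : ℕ in atTop, P {ω | ∀ θ ∈ Θ, ‖θ - θ₀‖ ≤ δ →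
      |remainder θ₀ L Δ J n θ ω| ≤ ε * (1 + n * ‖θ - θ₀‖ ^ 2)}ᶜ ≤ e := by
  obtain ⟨r, hr0, hre⟩ : ∃ r : ℝ, 0 < r ∧ ENNReal.ofReal r ≤ e / 2 := by
    have h2 : 0 < min (e / 2) 1 := lt_min (ENNReal.half_pos he.ne') one_pos
    have h3 : min (e / 2) 1 ≠ ⊤ := ne_top_of_le_ne_top ENNReal.one_ne_top (min_le_right _ _)
    refine ⟨(min (e / 2) 1).toReal, ENNReal.toReal_pos h2.ne' h3, ?_⟩
    rw [ENNReal.ofReal_toReal h3]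
    exact min_le_left _ _
  set ε' := min ε r with hε'
  have hε'0 : 0 < ε' := lt_min hε hr0
  obtain ⟨δ, hδ, M, hM, h1, h2⟩ := hExp.remainder_small ε' hε'0
  have hε'e : ENNReal.ofReal ε' ≤ e / 2 :=
    (ENNReal.ofReal_le_ofReal (min_le_right _ _)).trans hre
  have h3 := eventually_lt_of_limsup_lt h1
  have h4 := eventually_lt_of_limsup_lt (h2.trans_lt (ENNReal.ofReal_pos.2 hε'0))
  refine ⟨δ, hδ, ?_⟩
  filter_upwards [h3, h4, eventually_ge_atTop 1] with n h3 h4 hn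
  have hn0 : (0 : ℝ) < n := by exact_mod_cast hn
  refine (measure_mono (t := {ω | ∃ θ ∈ Θ, M / Real.sqrt n ≤ ‖θ - θ₀‖ ∧ ‖θ - θ₀‖ ≤ δ ∧
      ε' < |remainder θ₀ L Δ J n θ ω| / (n * ‖θ - θ₀‖ ^ 2)} ∪
      {ω | ∃ θ ∈ Θ, ‖θ - θ₀‖ ≤ M / Real.sqrt n ∧ ε' < |remainder θ₀ L Δ J n θ ω|}) ?_).trans ?_
  · intro ω hω
    simp only [Set.mem_compl_iff, Set.mem_ofPred_eq, not_forall, not_le] at hω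
    obtain ⟨θ, hθ, hθδ, hR⟩ := hω
    have hR' : ε' * (1 + n * ‖θ - θ₀‖ ^ 2) < |remainder θ₀ L Δ J n θ ω| :=
      lt_of_le_of_lt (mul_le_mul_of_nonneg_right (min_le_left _ _) (by positivity)) hR
    have hp : 0 ≤ ε' * (n * ‖θ - θ₀‖ ^ 2) := by positivity
    rcases le_total (‖θ - θ₀‖) (M / Real.sqrt n) with h | h
    · exact Or.inr ⟨θ, hθ, h, by linarith⟩
    · have hpos : 0 < ‖θ - θ₀‖ := (by positivity : 0 < M / Real.sqrt n).trans_le h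
      exact Or.inl ⟨θ, hθ, h, hθδ, by rw [lt_div_iff₀ (by positivity)]; linarith⟩
  · calc _ ≤ _ := measure_union_le _ _
      _ ≤ e / 2 + e / 2 := add_le_add (h3.le.trans hε'e) (h4.le.trans hε'e)
      _ = e := ENNReal.add_halves e

lemma exists_separation (hIdent : IdentifiabilityAssumption P Θ θ₀ L) {δ : ℝ} (hδ : 0 < δ) :
    ∃ ε > 0, ∀ e : ℝ≥0∞, 0 < e → ∀ᶠ n : ℕ in atTop, P {ω | ∀ θ ∈ Θ, δ ≤ ‖θ - θ₀‖ →
      (1 / (n : ℝ)) * (L n θ ω - L n θ₀ ω) ≤ -ε}ᶜ ≤ e := by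
  obtain ⟨ε, hε, h⟩ := hIdent δ hδ
  refine ⟨ε, hε, fun e he => ?_⟩
  have h1 : 1 - e < liminf (fun n : ℕ => innerProb P {ω | ∀ θ ∈ Θ, δ ≤ ‖θ - θ₀‖ →
      (1 / (n : ℝ)) * (L n θ ω - L n θ₀ ω) ≤ -ε}) atTop := by
    rw [h]
    exact ENNReal.sub_lt_self ENNReal.one_ne_top one_ne_zero he.ne'
  filter_upwards [eventually_lt_of_lt_liminf h1] with n hn
  by_contra! hcon
  exact absurd (tsub_le_tsub_left hcon.le 1) (not_le.2 hn)

lemma exists_norm_stdScore_le [IsProbabilityMeasure P]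
    (hExp : ExpansionAssumption P Θ θ₀ L Δ J Om) {e : ℝ≥0∞}
    (he : 0 < e) :
    ∃ C : ℝ, ∀ᶠ n : ℕ in atTop, P {ω | ‖stdScore Om Δ n ω‖ ≤ C}ᶜ ≤ e := by
  let F : ℕ → Set (EuclideanSpace ℝ (Fin d)) := fun m => {z | (m : ℝ) ≤ ‖z‖}
  have hF : ∀ m, IsClosed (F m) := fun m => isClosed_le continuous_const continuous_norm
  have h0 : Tendsto (fun m => stdGaussian (EuclideanSpace ℝ (Fin d)) (F m)) atTop (𝓝 0) := by
    have := tendsto_measure_iInter_atTop (μ := stdGaussian (EuclideanSpace ℝ (Fin d))) (s := F)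
      (fun m => (hF m).measurableSet.nullMeasurableSet)
      (fun m n hmn z (hz : (n : ℝ) ≤ ‖z‖) => le_trans (by exact_mod_cast hmn) hz)
      ⟨0, measure_ne_top _ _⟩
    have hempty : ⋂ m, F m = ∅ := by
      ext z
      obtain ⟨m, hm⟩ := exists_nat_gt ‖z‖
      simpa [F] using ⟨m, hm⟩
    simpa [hempty, Function.comp_def] using this
  obtain ⟨m, hm⟩ := (h0.eventually_lt_const he).exists
  refine ⟨m, ?_⟩
  have hclt := hExp.score_clt
  have h1 := ProbabilityMeasure.limsup_measure_closed_le_of_tendsto hclt.tendsto (hF m)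
  simp only [ProbabilityMeasure.coe_mk, Measure.map_id] at h1
  filter_upwards [eventually_lt_of_limsup_lt (h1.trans_lt hm)] with n hn
  rw [Measure.map_apply_of_aemeasurable (hclt.forall_aemeasurable n) (hF m).measurableSet] at hn
  refine (measure_mono fun ω hω => ?_).trans hn.le
  simp only [Set.mem_compl_iff, Set.mem_ofPred_eq, not_le] at hω
  exact hω.le

lemma eventually_measure_entry_le {A : ℕ → S → Matrix (Fin d) (Fin d) ℝ}
    {B : Matrix (Fin d) (Fin d) ℝ} (hA : MatrixTendstoInProb P A B) {ε : ℝ} (hε : 0 < ε)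
    {e : ℝ≥0∞} (he : 0 < e) :
    ∀ᶠ n : ℕ in atTop, P {ω | ∀ i j, |A n ω i j - B i j| ≤ ε}ᶜ ≤ e := by
  have h1 : Tendsto (fun n => ∑ i, ∑ j, P {ω | ε ≤ ‖A n ω i j - B i j‖}) atTop (𝓝 0) := by
    have : Tendsto (fun n => ∑ i, ∑ j, P {ω | ε ≤ ‖A n ω i j - B i j‖}) atTop
        (𝓝 (∑ _i : Fin d, ∑ _j : Fin d, 0)) := tendsto_finsetSum _ fun i _ =>
      tendsto_finsetSum _ fun j _ => (tendstoInMeasure_iff_norm.1 (hA i j)) ε hε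
    simpa using this
  filter_upwards [h1.eventually_lt_const he] with n hn
  refine le_trans ?_ hn.le
  refine (measure_mono (t := ⋃ i, ⋃ j, {ω | ε ≤ ‖A n ω i j - B i j‖}) ?_).trans
    ((measure_iUnion_fintype_le _ _).trans
      (Finset.sum_le_sum fun i _ => measure_iUnion_fintype_le _ _))
  intro ω hω
  simp only [Set.mem_compl_iff, Set.mem_ofPred_eq, not_forall, not_le] at hω
  obtain ⟨i, j, hij⟩ := hω
  exact Set.mem_iUnion.2 ⟨i, Set.mem_iUnion.2 ⟨j, hij.le⟩⟩

end Events

/-! ### Selecting deterministic paths -/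

/-- If the events `B k` keep probability at least `η` along a subsequence, while the exceptional
sets of countably many sequences of events `G i` have total probability less than `η`, one can
select outcomes in `B k` that lie in each `G i` from some index on. Only subadditivity of outer
measure is used, so no measurability is needed. -/
lemma exists_subseq_mem {S : Type*} [MeasurableSpace S] {P : Measure S} {B : ℕ → Set S}
    {η : ℝ≥0∞} (hB : ∃ᶠ k in atTop, η ≤ P (B k)) {G : ℕ → ℕ → Set S} {e : ℕ → ℝ≥0∞}
    (he : ∑' i, e i < η) (hG : ∀ i, ∀ᶠ k in atTop, P (G i k)ᶜ ≤ e i) :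
    ∃ φ : ℕ → ℕ, StrictMono φ ∧ ∃ ω : ℕ → S, (∀ k, ω k ∈ B (φ k)) ∧
      ∀ i k, i ≤ k → ω k ∈ G i (φ k) := by
  have h : ∀ m, ∃ᶠ k in atTop, ∃ ω ∈ B k, ∀ i ≤ m, ω ∈ G i k := by
    intro m
    have hall : ∀ᶠ k in atTop, ∀ i ∈ Finset.range (m + 1), P (G i k)ᶜ ≤ e i :=
      (Finset.eventually_all _).2 fun i _ => hG i
    refine (hB.and_eventually hall).mono fun k hk => ?_
    by_contra! hcon
    have hsub : B k ⊆ ⋃ i ∈ Finset.range (m + 1), (G i k)ᶜ := by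
      intro ω hω
      obtain ⟨i, hi, hn⟩ := hcon ω hω
      simp only [Set.mem_iUnion]
      exact ⟨i, Finset.mem_range.2 (by lia), hn⟩
    have := calc η ≤ P (B k) := hk.1
      _ ≤ P (⋃ i ∈ Finset.range (m + 1), (G i k)ᶜ) := measure_mono hsub
      _ ≤ ∑ i ∈ Finset.range (m + 1), P (G i k)ᶜ := measure_biUnion_finset_le _ _
      _ ≤ ∑ i ∈ Finset.range (m + 1), e i := Finset.sum_le_sum hk.2
      _ ≤ ∑' i, e i := ENNReal.sum_le_tsum _
    exact absurd he (not_lt.2 this)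
  obtain ⟨φ, hφ, hmem⟩ := extraction_forall_of_frequently h
  choose ω hωB hωG using hmem
  exact ⟨φ, hφ, ω, hωB, fun i k hik => hωG k i hik⟩

lemma remainder_eq {S : Type*} {θ₀ : EuclideanSpace ℝ (Fin d)}
    {L : ℕ → EuclideanSpace ℝ (Fin d) → S → ℝ} {Δ : ℕ → S → EuclideanSpace ℝ (Fin d)}
    {J : ℕ → Matrix (Fin d) (Fin d) ℝ} {n : ℕ} (hn : 1 ≤ n) (θ : EuclideanSpace ℝ (Fin d)) (ω : S) :
    remainder θ₀ L Δ J n θ ω = L n θ ω - L n θ₀ ω -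
      (inner ℝ (Real.sqrt n • (θ - θ₀)) ((Real.sqrt n)⁻¹ • Δ n ω) -
        1 / 2 * quadForm (J n) (Real.sqrt n • (θ - θ₀))) := by
  have hs : Real.sqrt n ≠ 0 := (Real.sqrt_pos.2 (by exact_mod_cast hn)).ne'
  have h1 : inner ℝ (Real.sqrt n • (θ - θ₀)) ((Real.sqrt n)⁻¹ • Δ n ω) =
      inner ℝ (θ - θ₀) (Δ n ω) := by
    rw [real_inner_smul_left, real_inner_smul_right, mul_inv_cancel_left₀ hs]
  have h2 : quadForm (J n) (Real.sqrt n • (θ - θ₀)) = quadForm ((n : ℝ) • J n) (θ - θ₀) := by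
    simp only [quadForm, WithLp.ofLp_smul, mulVec_smul, smul_mulVec, dotProduct_smul,
      smul_dotProduct, smul_eq_mul, ← mul_assoc, Real.mul_self_sqrt (Nat.cast_nonneg n)]
  rw [remainder, h1, h2]

lemma norm_sqrt_smul_sq (n : ℕ) (v : EuclideanSpace ℝ (Fin d)) :
    ‖Real.sqrt n • v‖ ^ 2 = n * ‖v‖ ^ 2 := by
  rw [norm_smul, mul_pow, Real.norm_eq_abs, sq_abs, Real.sq_sqrt (Nat.cast_nonneg n)]

/-- A sequence of sample sizes `N k → ∞` and outcomes `ω k` along which the criterion function is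
asymptotically quadratic and all matrices and the standardized score converge. The limits are `J₀`,
`Om₀`, `S₀` (of the inverse square root of `Om`) and `z`. -/
structure ConvergentPath {S : Type*} (Θ : Set (EuclideanSpace ℝ (Fin d)))
    (θ₀ : EuclideanSpace ℝ (Fin d)) (L : ℕ → EuclideanSpace ℝ (Fin d) → S → ℝ)
    (Δ : ℕ → S → EuclideanSpace ℝ (Fin d)) (J Om : ℕ → Matrix (Fin d) (Fin d) ℝ)
    (OmHat : ℕ → S → Matrix (Fin d) (Fin d) ℝ) (N : ℕ → ℕ) (ω : ℕ → S)
    (J₀ Om₀ S₀ : Matrix (Fin d) (Fin d) ℝ) (z : EuclideanSpace ℝ (Fin d)) : Prop where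
  size : Tendsto N atTop atTop
  quadratic : QuadraticAlong Θ θ₀ (fun k => Real.sqrt (N k)) (fun k θ => L (N k) θ (ω k))
    (fun k => J (N k)) (fun k => (Real.sqrt (N k))⁻¹ • Δ (N k) (ω k)) J₀
    (WithLp.toLp 2 (Om₀ *ᵥ S₀ *ᵥ z.ofLp))
  tendsto_Om : Tendsto (fun k => Om (N k)) atTop (𝓝 Om₀)
  tendsto_sqrt : Tendsto (fun k => CFC.sqrt (Om (N k))⁻¹) atTop (𝓝 S₀)
  tendsto_stdScore : Tendsto (fun k => stdScore Om Δ (N k) (ω k)) atTop (𝓝 z)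
  tendsto_OmHat : Tendsto (fun k => OmHat (N k) (ω k)) atTop (𝓝 Om₀)

section Paths

variable {S : Type*} [MeasurableSpace S] {P : Measure S}
  {Θ : Set (EuclideanSpace ℝ (Fin d))} {θ₀ : EuclideanSpace ℝ (Fin d)}
  {L : ℕ → EuclideanSpace ℝ (Fin d) → S → ℝ} {Δ : ℕ → S → EuclideanSpace ℝ (Fin d)}
  {J Om : ℕ → Matrix (Fin d) (Fin d) ℝ} {OmHat : ℕ → S → Matrix (Fin d) (Fin d) ℝ}

lemma limit_mul_sqrt_mul_sqrt (hOm : BoundedUniformlyPosDef Om) {N : ℕ → ℕ}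
    (hN : Tendsto N atTop atTop) {Om₀ S₀ : Matrix (Fin d) (Fin d) ℝ}
    (h1 : Tendsto (fun k => Om (N k)) atTop (𝓝 Om₀))
    (h2 : Tendsto (fun k => CFC.sqrt (Om (N k))⁻¹) atTop (𝓝 S₀)) :
    Om₀ * (S₀ * S₀) = 1 ∧ S₀.IsSymm := by
  obtain ⟨c, hc, hpos⟩ := hOm.uniformly_pos
  constructor
  · refine tendsto_nhds_unique (h1.mul (h2.mul h2)) (tendsto_const_nhds.congr' ?_)
    filter_upwards [hN.eventually_ge_atTop 1] with k hk
    have hpd := posDef_of_quadForm (hOm.isSymm _ hk) hc (hpos _ hk)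
    rw [sqrt_inv_mul_self hpd, mul_nonsing_inv _ ((isUnit_iff_isUnit_det _).1 hpd.isUnit)]
  · exact tendsto_nhds_unique_of_eventuallyEq
      ((Continuous.matrix_transpose continuous_id).tendsto S₀ |>.comp h2) h2
      (Eventually.of_forall fun k => isSymm_sqrt _)

/-- Passage from outer probabilities to deterministic paths: a sequence of events whose
probabilities do not tend to zero contains a convergent path. -/
theorem exists_convergentPath [IsProbabilityMeasure P] (hMeas : CriterionMeasurable Θ L)
    (hIdent : IdentifiabilityAssumption P Θ θ₀ L) (hExp : ExpansionAssumption P Θ θ₀ L Δ J Om)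
    (hOmHat : MatrixTendstoInProb P (fun n ω => OmHat n ω * (Om n)⁻¹) 1)
    {N : ℕ → ℕ} (hN : Tendsto N atTop atTop) {B : ℕ → Set S}
    (hB : ¬ Tendsto (fun k => P (B k)) atTop (𝓝 0)) :
    ∃ φ : ℕ → ℕ, StrictMono φ ∧ ∃ ω : ℕ → S, (∀ k, ω k ∈ B (φ k)) ∧
      ∃ J₀ Om₀ S₀ z, ConvergentPath Θ θ₀ L Δ J Om OmHat (fun k => N (φ k)) ω J₀ Om₀ S₀ z := by
  obtain ⟨η, hη, hfreq⟩ : ∃ η > 0, ∃ᶠ k in atTop, η ≤ P (B k) := by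
    rw [ENNReal.tendsto_nhds_zero] at hB
    push Not at hB
    obtain ⟨η, hη, h⟩ := hB
    exact ⟨η, hη, h.mono fun k hk => hk.le⟩
  -- the `i`-th group of four events may fail with probability at most `e i`, and `∑ e i < η`
  obtain ⟨e, he0, he⟩ := ENNReal.exists_pos_sum_of_countable' hη.ne' ℕ
  have he4 : ∀ i, 0 < e i / 4 := fun i => ENNReal.div_pos (he0 i).ne' (by norm_num)
  have hr : ∀ i : ℕ, (0 : ℝ) < 1 / ((i : ℝ) + 1) := fun i => Nat.one_div_pos_of_nat
  choose δ hδ hrem using fun i => exists_remainder_le hExp (hr i) (he4 i)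
  choose ε hε hsep using fun i => exists_separation hIdent (hr i)
  choose C hC using fun i => exists_norm_stdScore_le hExp (he4 i)
  have hOmE := fun i => eventually_measure_entry_le hOmHat (hr i) (he4 i)
  set G : ℕ → ℕ → Set S := fun i n =>
    (({ω | ∀ θ ∈ Θ, ‖θ - θ₀‖ ≤ δ i →
        |remainder θ₀ L Δ J n θ ω| ≤ 1 / ((i : ℝ) + 1) * (1 + n * ‖θ - θ₀‖ ^ 2)} ∩
      {ω | ∀ θ ∈ Θ, 1 / ((i : ℝ) + 1) ≤ ‖θ - θ₀‖ →
        (1 / (n : ℝ)) * (L n θ ω - L n θ₀ ω) ≤ -ε i}) ∩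
      {ω | ‖stdScore Om Δ n ω‖ ≤ C i}) ∩
      {ω | ∀ a b, |(OmHat n ω * (Om n)⁻¹) a b - (1 : Matrix (Fin d) (Fin d) ℝ) a b| ≤
        1 / ((i : ℝ) + 1)} with hGdef
  have hG : ∀ i, ∀ᶠ n in atTop, P (G i n)ᶜ ≤ e i := by
    intro i
    filter_upwards [hrem i, hsep i _ (he4 i), hC i, hOmE i] with n h1 h2 h3 h4
    rw [hGdef]
    simp only [Set.compl_inter]
    calc _ ≤ _ := (measure_union_le _ _).trans (add_le_add ((measure_union_le _ _).trans
          (add_le_add (measure_union_le _ _) le_rfl)) le_rfl)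
      _ ≤ e i / 4 + e i / 4 + e i / 4 + e i / 4 :=
          add_le_add (add_le_add (add_le_add h1 h2) h3) h4
      _ = 4 * (e i / 4) := by ring
      _ = e i := ENNReal.mul_div_cancel (by norm_num) (by norm_num)
  obtain ⟨φ, hφ, ω, hωB, hωG⟩ := exists_subseq_mem hfreq he fun i => hN.eventually (hG i)
  -- compactness: first the matrices converge, then the score, which is bounded by the event `G 0`
  have hNφ : Tendsto (fun k => N (φ k)) atTop atTop := hN.comp hφ.tendsto_atTop
  obtain ⟨ψ, hψ, J₀, Om₀, S₀, hJ₀, hOm₀, hS₀⟩ :=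
    exists_subseq_matrices hExp.curvature hExp.variance hNφ
  obtain ⟨z, -, χ, hχ, hz⟩ :=
    (isCompact_closedBall (0 : EuclideanSpace ℝ (Fin d)) (C 0)).tendsto_subseq
      (x := fun k => stdScore Om Δ (N (φ (ψ k))) (ω (ψ k)))
      (fun k => by simpa using (hωG 0 (ψ k) (Nat.zero_le _)).1.2)
  have hχt := hχ.tendsto_atTop
  have hmono : StrictMono fun k => ψ (χ k) := hψ.comp hχ
  have hsize : Tendsto (fun k => N (φ (ψ (χ k)))) atTop atTop :=
    hNφ.comp hmono.tendsto_atTop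
  have hone := hsize.eventually_ge_atTop 1
  obtain ⟨cO, hcO, hposO⟩ := hExp.variance.uniformly_pos
  obtain ⟨cJ, hcJ, hposJ⟩ := hExp.curvature.uniformly_pos
  have hG' : ∀ i, ∀ᶠ k in atTop, ω (ψ (χ k)) ∈ G i (N (φ (ψ (χ k)))) := fun i =>
    (hmono.tendsto_atTop.eventually_ge_atTop i).mono fun k hk => hωG i _ hk
  have hsmall : ∀ r : ℝ, 0 < r → ∃ i : ℕ, 1 / ((i : ℝ) + 1) < r := fun r hr =>
    exists_nat_one_div_lt hr
  refine ⟨fun k => φ (ψ (χ k)), hφ.comp hmono, fun k => ω (ψ (χ k)), fun k => hωB _, J₀, Om₀, S₀, z,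
    hsize, ?_, hOm₀.comp hχt, hS₀.comp hχt, hz, ?_⟩
  · refine ⟨fun k => hMeas.measurable_param _ _, ?_, ?_, ?_, ⟨cJ, hcJ, hone.mono fun k hk =>
      hposJ _ hk⟩, hone.mono fun k hk => hExp.curvature.isSymm _ hk, hJ₀.comp hχt, ?_⟩
    · exact Real.tendsto_sqrt_atTop.comp (tendsto_natCast_atTop_atTop.comp hsize)
    · intro r hr
      obtain ⟨i, hi⟩ := hsmall r hr
      refine ⟨δ i, hδ i, ?_⟩
      filter_upwards [hG' i, hone] with k hk hk1 θ hθ hθδ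
      rw [← remainder_eq hk1, norm_sqrt_smul_sq]
      exact (hk.1.1.1 θ hθ hθδ).trans (mul_le_mul_of_nonneg_right hi.le (by positivity))
    · intro r hr
      obtain ⟨i, hi⟩ := hsmall r hr
      refine ⟨ε i, hε i, ?_⟩
      filter_upwards [hG' i, hone] with k hk hk1 θ hθ hθδ
      have hn0 : (0 : ℝ) < N (φ (ψ (χ k))) := by exact_mod_cast hk1
      have := hk.1.1.2 θ hθ (hi.le.trans hθδ)
      rw [one_div, inv_mul_le_iff₀ hn0] at this
      rw [Real.sq_sqrt hn0.le]
      linarith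
    -- the score is recovered from its standardization, as `Om S S = 1` for `S = Om^{-1/2}`
    · have hlim : Tendsto (fun k => (WithLp.toLp 2 (Om (N (φ (ψ (χ k)))) *ᵥ
          CFC.sqrt (Om (N (φ (ψ (χ k)))))⁻¹ *ᵥ
            (stdScore Om Δ (N (φ (ψ (χ k)))) (ω (ψ (χ k)))).ofLp) :
            EuclideanSpace ℝ (Fin d))) atTop (𝓝 (WithLp.toLp 2 (Om₀ *ᵥ S₀ *ᵥ z.ofLp))) := by
        have hc : Continuous fun p : Matrix (Fin d) (Fin d) ℝ × Matrix (Fin d) (Fin d) ℝ ×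
            EuclideanSpace ℝ (Fin d) =>
            (WithLp.toLp 2 (p.1 *ᵥ p.2.1 *ᵥ p.2.2.ofLp) : EuclideanSpace ℝ (Fin d)) := by
          fun_prop
        exact (hc.tendsto (Om₀, S₀, z)).comp
          ((hOm₀.comp hχt).prodMk_nhds ((hS₀.comp hχt).prodMk_nhds hz))
      refine hlim.congr' ?_
      filter_upwards [hone] with k hk
      have hpd := posDef_of_quadForm (hExp.variance.isSymm _ hk) hcO (hposO _ hk)
      rw [stdScore, ofLp_toEuclideanCLM, mulVec_mulVec, mulVec_mulVec, mul_assoc,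
        sqrt_inv_mul_self hpd,
        mul_nonsing_inv _ ((isUnit_iff_isUnit_det _).1 hpd.isUnit), one_mulVec]
  · have h1 : Tendsto (fun k => OmHat (N (φ (ψ (χ k)))) (ω (ψ (χ k))) *
        (Om (N (φ (ψ (χ k)))))⁻¹) atTop (𝓝 1) := by
      refine tendsto_pi_nhds.2 fun a => tendsto_pi_nhds.2 fun b => ?_
      rw [Metric.tendsto_nhds]
      intro r hr
      obtain ⟨i, hi⟩ := hsmall r hr
      filter_upwards [hG' i] with k hk
      exact (hk.2 a b).trans_lt hi
    have h2 := h1.mul (hOm₀.comp hχt)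
    rw [one_mul] at h2
    refine h2.congr' ?_
    filter_upwards [hone] with k hk
    have hpd := posDef_of_quadForm (hExp.variance.isSymm _ hk) hcO (hposO _ hk)
    simp only [Function.comp_apply]
    rw [mul_assoc, nonsing_inv_mul _ ((isUnit_iff_isUnit_det _).1 hpd.isUnit), mul_one]

end Paths

/-! ### The standard normal distribution -/

lemma map_inner_stdGaussian {a : EuclideanSpace ℝ (Fin d)} (ha : ‖a‖ = 1) :
    (stdGaussian (EuclideanSpace ℝ (Fin d))).map (fun z => inner ℝ a z) = gaussianReal 0 1 := by
  have h := IsGaussian.map_eq_gaussianReal (μ := stdGaussian (EuclideanSpace ℝ (Fin d)))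
    (innerSL ℝ a)
  rw [integral_strongDual_stdGaussian, variance_dual_stdGaussian, innerSL_apply_norm, ha] at h
  simpa using h

lemma continuous_cdf_stdNormal : Continuous (cdf (gaussianReal 0 1)) := by
  have := nullSingletonClass_gaussianReal (μ := 0) (v := 1) one_ne_zero
  refine continuous_iff_continuousAt.2 fun x => ?_
  rw [(monotone_cdf _).continuousAt_iff_leftLim_eq_rightLim, StieltjesFunction.rightLim_eq]
  have h : (cdf (gaussianReal 0 1)).measure {x} = 0 := by
    rw [measure_cdf]
    exact measure_singleton x
  rw [StieltjesFunction.measure_singleton, ENNReal.ofReal_eq_zero] at h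
  exact le_antisymm ((monotone_cdf _).leftLim_le le_rfl) (by linarith)

lemma cdf_stdNormalQuantile {p : ℝ} (h0 : 0 < p) (h1 : p < 1) :
    cdf (gaussianReal 0 1) (stdNormalQuantile p) = p := by
  set F := cdf (gaussianReal 0 1) with hF
  have hc : Continuous F := continuous_cdf_stdNormal
  set A : Set ℝ := {x | p ≤ F x} with hA
  have hAc : IsClosed A := isClosed_le continuous_const hc
  have hne : A.Nonempty := by
    obtain ⟨x, hx⟩ := ((tendsto_cdf_atTop (gaussianReal 0 1)).eventually_const_lt h1).exists
    exact ⟨x, hx.le⟩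
  have hbdd : BddBelow A := by
    obtain ⟨x, hx⟩ := ((tendsto_cdf_atBot (gaussianReal 0 1)).eventually_lt_const h0).exists
    refine ⟨x, fun y hy => ?_⟩
    by_contra! hlt
    exact absurd (hy.trans ((monotone_cdf _) hlt.le)) (not_le.2 hx)
  have hq : stdNormalQuantile p = sInf A := rfl
  rw [hq]
  refine le_antisymm ?_ (hAc.csInf_mem hne hbdd)
  have hlim : Tendsto F (𝓝[<] (sInf A)) (𝓝 (F (sInf A))) :=
    (hc.tendsto _).mono_left nhdsWithin_le_nhds
  refine le_of_tendsto hlim ?_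
  filter_upwards [self_mem_nhdsWithin] with x hx
  exact (not_le.1 fun h => notMem_of_lt_csInf hx hbdd h).le

lemma stdNormal_Icc (a b : ℝ) : gaussianReal 0 1 (Set.Icc a b) =
    ENNReal.ofReal (cdf (gaussianReal 0 1) b - cdf (gaussianReal 0 1) a) := by
  have := nullSingletonClass_gaussianReal (μ := 0) (v := 1) one_ne_zero
  rw [← measure_congr Ioc_ae_eq_Icc, ← StieltjesFunction.measure_Ioc, measure_cdf]

lemma stdNormal_compl_Icc (a b : ℝ) : gaussianReal 0 1 (Set.Icc a b)ᶜ =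
    1 - ENNReal.ofReal (cdf (gaussianReal 0 1) b - cdf (gaussianReal 0 1) a) := by
  rw [prob_compl_eq_one_sub measurableSet_Icc, stdNormal_Icc]

/-- Coverage of an interval by a statistic `W k` that need not be measurable but is close in outer
probability to random variables `T k` whose distribution is asymptotically standard normal. The
event `A k` is only assumed to agree with `W k ∈ [q₁, q₂]` up to small outer probability. -/
lemma tendsto_innerProb_of_close {S : Type*} [MeasurableSpace S] {P : Measure S}
    {A : ℕ → Set S} {W T : ℕ → S → ℝ} {q₁ q₂ : ℝ}
    (hT : ∀ a b, Tendsto (fun k => P {ω | T k ω ∈ (Set.Icc a b)ᶜ}) atTop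
      (𝓝 (gaussianReal 0 1 (Set.Icc a b)ᶜ)))
    (hbad : ∀ η > 0, Tendsto (fun k => P {ω | ¬ (ω ∈ A k ↔ W k ω ∈ Set.Icc q₁ q₂) ∨
      η ≤ |W k ω - T k ω|}) atTop (𝓝 0)) :
    Tendsto (fun k => innerProb P (A k)) atTop
      (𝓝 (ENNReal.ofReal (cdf (gaussianReal 0 1) q₂ - cdf (gaussianReal 0 1) q₁))) := by
  have hc := continuous_cdf_stdNormal
  have hρ : ∀ s₁ s₂ : ℝ, Tendsto
      (fun η : ℝ => gaussianReal 0 1 (Set.Icc (q₁ + s₁ * η) (q₂ + s₂ * η))ᶜ) (𝓝[>] 0)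
      (𝓝 (gaussianReal 0 1 (Set.Icc q₁ q₂)ᶜ)) := by
    intro s₁ s₂
    simp only [stdNormal_compl_Icc]
    have h : Tendsto (fun η : ℝ => ENNReal.ofReal (cdf (gaussianReal 0 1) (q₂ + s₂ * η) -
        cdf (gaussianReal 0 1) (q₁ + s₁ * η))) (𝓝[>] 0)
        (𝓝 (ENNReal.ofReal (cdf (gaussianReal 0 1) q₂ - cdf (gaussianReal 0 1) q₁))) := by
      have h1 : Continuous fun η : ℝ => ENNReal.ofReal (cdf (gaussianReal 0 1) (q₂ + s₂ * η) -
        cdf (gaussianReal 0 1) (q₁ + s₁ * η)) :=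
        ENNReal.continuous_ofReal.comp ((hc.comp (by fun_prop)).sub (hc.comp (by fun_prop)))
      have h2 := h1.tendsto 0
      simp only [mul_zero, add_zero] at h2
      exact h2.mono_left nhdsWithin_le_nhds
    exact ENNReal.Tendsto.sub tendsto_const_nhds h (Or.inl ENNReal.one_ne_top)
  have key : Tendsto (fun k => P (A k)ᶜ) atTop (𝓝 (gaussianReal 0 1 (Set.Icc q₁ q₂)ᶜ)) := by
    refine tendsto_order.2 ⟨fun u hu => ?_, fun u hu => ?_⟩
    · obtain ⟨η, hη, hη0⟩ := (((hρ (-1) 1).eventually_const_lt hu).and self_mem_nhdsWithin).exists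
      have hη0' : 0 < η := hη0
      have hlim := ENNReal.Tendsto.sub (hT (q₁ + -1 * η) (q₂ + 1 * η)) (hbad η hη0')
        (Or.inr ENNReal.zero_ne_top)
      rw [tsub_zero] at hlim
      filter_upwards [hlim.eventually_const_lt hη] with k hk
      refine hk.trans_le (tsub_le_iff_right.2 ((measure_mono ?_).trans (measure_union_le _ _)))
      intro ω hω
      by_contra hcon
      simp only [Set.mem_union, Set.mem_compl_iff, Set.mem_ofPred_eq, not_or, not_not, not_le]
        at hcon hω
      have hW := hcon.2.1.1 hcon.1
      have habs := abs_lt.1 hcon.2.2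
      exact hω ⟨by linarith [hW.1], by linarith [hW.2]⟩
    · obtain ⟨η, hη, hη0⟩ := (((hρ 1 (-1)).eventually_lt_const hu).and self_mem_nhdsWithin).exists
      have hη0' : 0 < η := hη0
      have hlim := (hT (q₁ + 1 * η) (q₂ + -1 * η)).add (hbad η hη0')
      rw [add_zero] at hlim
      filter_upwards [hlim.eventually_lt_const hη] with k hk
      refine ((measure_mono ?_).trans (measure_union_le _ _)).trans_lt hk
      intro ω hω
      by_contra hcon
      simp only [Set.mem_union, Set.mem_compl_iff, Set.mem_ofPred_eq, not_or, not_not, not_le]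
        at hcon hω
      have habs := abs_lt.1 hcon.2.2
      exact hω (hcon.2.1.2 ⟨by linarith [hcon.1.1], by linarith [hcon.1.2]⟩)
  have h2 := ENNReal.Tendsto.sub (tendsto_const_nhds (x := (1 : ℝ≥0∞))) key
    (Or.inl ENNReal.one_ne_top)
  rw [stdNormal_compl_Icc, ENNReal.sub_sub_cancel ENNReal.one_ne_top
    (by rw [← stdNormal_Icc]; exact prob_le_one)] at h2
  exact h2

/-! ### Consistency and the delta method along paths -/

section Inference

variable {S : Type*} [MeasurableSpace S] {P : Measure S}
  {Θ : Set (EuclideanSpace ℝ (Fin d))} {θ₀ : EuclideanSpace ℝ (Fin d)}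
  {π : EuclideanSpace ℝ (Fin d) → ℝ}
  {L : ℕ → EuclideanSpace ℝ (Fin d) → S → ℝ} {Δ : ℕ → S → EuclideanSpace ℝ (Fin d)}
  {J Om : ℕ → Matrix (Fin d) (Fin d) ℝ} {OmHat : ℕ → S → Matrix (Fin d) (Fin d) ℝ}

lemma QuadraticAlong.tendsto_quasiMean_and_scaledQuasiCov_of_assumptions {N : ℕ → ℕ}
    {ℓ : ℕ → EuclideanSpace ℝ (Fin d) → ℝ} {J : ℕ → Matrix (Fin d) (Fin d) ℝ}
    {x : ℕ → EuclideanSpace ℝ (Fin d)} {J₀ : Matrix (Fin d) (Fin d) ℝ}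
    {x₀ : EuclideanSpace ℝ (Fin d)} (hParam : ParameterAssumption Θ θ₀)
    (hPrior : PriorAssumption Θ π)
    (H : QuadraticAlong Θ θ₀ (fun k => Real.sqrt (N k)) ℓ J x J₀ x₀) :
    Tendsto (fun k => Real.sqrt (N k) • (quasiMean Θ π (ℓ k) - θ₀)) atTop
        (𝓝 (WithLp.toLp 2 (J₀⁻¹ *ᵥ x₀.ofLp))) ∧
      Tendsto (fun k => scaledQuasiCov Θ π (ℓ k) (N k)) atTop (𝓝 J₀⁻¹) := by
  obtain ⟨c, hc, hpos⟩ := hPrior.uniformly_pos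
  exact H.tendsto_quasiMean_and_scaledQuasiCov hParam.isCompact
    (mem_interior_iff_mem_nhds.1 hParam.mem_interior) hPrior.continuousOn
    (hc.trans_le (hpos _ (interior_subset hParam.mem_interior)))

lemma QuadraticAlong.limit_posDef {s : ℕ → ℝ}
    {ℓ : ℕ → EuclideanSpace ℝ (Fin d) → ℝ} {J : ℕ → Matrix (Fin d) (Fin d) ℝ}
    {x : ℕ → EuclideanSpace ℝ (Fin d)} {J₀ : Matrix (Fin d) (Fin d) ℝ}
    {x₀ : EuclideanSpace ℝ (Fin d)} (H : QuadraticAlong Θ θ₀ s ℓ J x J₀ x₀) : J₀.PosDef := by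
  obtain ⟨c, hc, hpos⟩ := H.limit_curvature_pos
  exact posDef_of_quadForm H.limit_curvature_symm hc hpos

lemma tendsto_matrix_inv {ι : Type*} {l : Filter ι} {A : ι → Matrix (Fin d) (Fin d) ℝ}
    {A₀ : Matrix (Fin d) (Fin d) ℝ} (h₀ : IsUnit A₀) (hA : Tendsto A l (𝓝 A₀)) :
    Tendsto (fun k => (A k)⁻¹) l (𝓝 A₀⁻¹) := by
  have hdet : A₀.det ≠ 0 := ((isUnit_iff_isUnit_det A₀).1 h₀).ne_zero
  simp only [Matrix.inv_def, Ring.inverse_eq_inv']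
  have hd : Tendsto (fun k => (A k).det) l (𝓝 A₀.det) :=
    ((Continuous.matrix_det continuous_id).tendsto A₀).comp hA
  exact (hd.inv₀ hdet).smul (((Continuous.matrix_adjugate continuous_id).tendsto A₀).comp hA)

/-- A matrix-valued functional of the data converges in outer probability as soon as it converges
along every convergent path. -/
lemma matrixTendstoInProb_of_paths [IsProbabilityMeasure P] (hMeas : CriterionMeasurable Θ L)
    (hIdent : IdentifiabilityAssumption P Θ θ₀ L) (hExp : ExpansionAssumption P Θ θ₀ L Δ J Om)
    {A : ℕ → S → Matrix (Fin d) (Fin d) ℝ} {B : Matrix (Fin d) (Fin d) ℝ}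
    (h : ∀ (N : ℕ → ℕ) (ω : ℕ → S) (J₀ Om₀ S₀ : Matrix (Fin d) (Fin d) ℝ)
      (z : EuclideanSpace ℝ (Fin d)),
      ConvergentPath Θ θ₀ L Δ J Om (fun n _ => Om n) N ω J₀ Om₀ S₀ z →
      Tendsto (fun k => A (N k) (ω k)) atTop (𝓝 B)) :
    MatrixTendstoInProb P A B := by
  have hOm : MatrixTendstoInProb P (fun n (_ : S) => Om n * (Om n)⁻¹) 1 := by
    intro i j
    rw [tendstoInMeasure_iff_norm]
    intro ε hε
    refine tendsto_const_nhds.congr' ?_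
    obtain ⟨c, hc, hpos⟩ := hExp.variance.uniformly_pos
    filter_upwards [eventually_ge_atTop 1] with n hn
    have hpd := posDef_of_quadForm (hExp.variance.isSymm _ hn) hc (hpos _ hn)
    rw [mul_nonsing_inv _ ((isUnit_iff_isUnit_det _).1 hpd.isUnit)]
    simp [not_le.2 hε]
  intro i j
  rw [tendstoInMeasure_iff_norm]
  intro ε hε
  by_contra hcon
  obtain ⟨φ, hφ, ω, hω, J₀, Om₀, S₀, z, hp⟩ :=
    exists_convergentPath hMeas hIdent hExp hOm tendsto_id hcon
  have h1 := tendsto_pi_nhds.1 (tendsto_pi_nhds.1 (h _ _ _ _ _ _ hp) i) j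
  have h2 := (h1.sub_const (B i j)).norm
  rw [sub_self, norm_zero] at h2
  obtain ⟨k, hk⟩ := (h2.eventually_lt_const hε).exists
  exact absurd (hω k) (not_le.2 hk)

lemma tendsto_deltaMethod {g : EuclideanSpace ℝ (Fin d) → ℝ} (hg : ContDiffAt ℝ 1 g θ₀)
    {N : ℕ → ℕ} (hN : Tendsto N atTop atTop) {θ : ℕ → EuclideanSpace ℝ (Fin d)}
    {u : EuclideanSpace ℝ (Fin d)}
    (hθ : Tendsto (fun k => Real.sqrt (N k) • (θ k - θ₀)) atTop (𝓝 u)) :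
    Tendsto (fun k => Real.sqrt (N k) * (g (θ k) - g θ₀)) atTop (𝓝 (inner ℝ (gradient g θ₀) u)) ∧
      Tendsto (fun k => gradient g (θ k)) atTop (𝓝 (gradient g θ₀)) := by
  have hs : Tendsto (fun k => Real.sqrt (N k)) atTop atTop :=
    Real.tendsto_sqrt_atTop.comp (tendsto_natCast_atTop_atTop.comp hN)
  have hθ₀ : Tendsto (fun k => θ k - θ₀) atTop (𝓝 0) := by
    have := hs.inv_tendsto_atTop.smul hθ
    rw [zero_smul] at this
    refine this.congr' ?_
    filter_upwards [hs.eventually_gt_atTop 0] with k hk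
    simp only [Pi.inv_apply, smul_smul, inv_mul_cancel₀ hk.ne', one_smul]
  constructor
  · have hd := (hg.differentiableAt one_ne_zero).hasFDerivAt.hasFDerivWithinAt (s := Set.univ)
    have := hd.lim (c := fun k => Real.sqrt (N k)) (d := fun k => θ k - θ₀) hθ₀
      (Eventually.of_forall fun _ => Set.mem_univ _) hθ
    simpa [gradient, InnerProductSpace.toDual_symm_apply] using this
  · have hc : ContinuousAt (gradient g) θ₀ :=
      (InnerProductSpace.toDual ℝ (EuclideanSpace ℝ (Fin d))).symm.continuous.continuousAt.comp
        (hg.continuousAt_fderiv one_ne_zero)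
    refine hc.tendsto.comp ?_
    simpa using hθ₀.add_const θ₀

end Inference

/-! ### Asymptotic coverage -/

/-- With `a = S₀ Om₀ J₀⁻¹ v`, the vector through which the standardized score enters the linearized
estimator, `|a|²` is the sandwich variance `v' J₀⁻¹ Om₀ J₀⁻¹ v`. -/
lemma sandwich_identities {J₀ Om₀ S₀ : Matrix (Fin d) (Fin d) ℝ} (hJ : J₀.IsSymm)
    (hOm : Om₀.IsSymm) (hS : S₀.IsSymm) (hOS : Om₀ * (S₀ * S₀) = 1)
    (v z : EuclideanSpace ℝ (Fin d)) :
    ‖(WithLp.toLp 2 (S₀ *ᵥ Om₀ *ᵥ J₀⁻¹ *ᵥ v.ofLp) : EuclideanSpace ℝ (Fin d))‖ ^ 2 =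
        quadForm (J₀⁻¹ * Om₀ * J₀⁻¹) v ∧
      inner ℝ v (WithLp.toLp 2 (J₀⁻¹ *ᵥ Om₀ *ᵥ S₀ *ᵥ z.ofLp)) =
        inner ℝ (WithLp.toLp 2 (S₀ *ᵥ Om₀ *ᵥ J₀⁻¹ *ᵥ v.ofLp) : EuclideanSpace ℝ (Fin d)) z := by
  have hswap : ∀ {A : Matrix (Fin d) (Fin d) ℝ}, A.IsSymm → ∀ x y : Fin d → ℝ,
      (A *ᵥ x) ⬝ᵥ y = x ⬝ᵥ (A *ᵥ y) := fun {A} hA x y => by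
    rw [dotProduct_mulVec, ← mulVec_transpose, hA.eq]
  have hJi : J₀⁻¹.IsSymm := by
    rw [IsSymm, transpose_nonsing_inv, hJ.eq]
  have hin : ∀ x y : EuclideanSpace ℝ (Fin d), inner ℝ x y = x.ofLp ⬝ᵥ y.ofLp := fun x y => by
    rw [EuclideanSpace.inner_eq_star_dotProduct, star_trivial, dotProduct_comm]
  have hSO : S₀ * (S₀ * Om₀) = 1 := by
    rw [← mul_assoc]
    exact mul_eq_one_comm.1 hOS
  constructor
  · rw [← real_inner_self_eq_norm_sq, hin, quadForm]
    simp only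
    have hSOJ : S₀ * (S₀ * (Om₀ * J₀⁻¹)) = J₀⁻¹ := by
      rw [← mul_assoc S₀ Om₀, ← mul_assoc, hSO, one_mul]
    rw [hswap hS, hswap hOm, hswap hJi]
    simp only [mulVec_mulVec, hSOJ, mul_assoc]
  · rw [hin, hin]
    simp only
    rw [hswap hS, hswap hOm, hswap hJi]

/-- The studentized statistic `√n (g θ₀ - g θhat) / σhat`. It has the junk value `0` where the
variance estimate is not positive; this happens with outer probability tending to zero. -/
noncomputable def studentized (Θ : Set (EuclideanSpace ℝ (Fin d))) (θ₀ : EuclideanSpace ℝ (Fin d))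
    (π ℓ : EuclideanSpace ℝ (Fin d) → ℝ) (n : ℕ) (Om : Matrix (Fin d) (Fin d) ℝ)
    (g : EuclideanSpace ℝ (Fin d) → ℝ) : ℝ :=
  Real.sqrt n * (g θ₀ - g (quasiMean Θ π ℓ)) /
    Real.sqrt (quadForm (scaledQuasiCov Θ π ℓ n * Om * scaledQuasiCov Θ π ℓ n)
      (gradient g (quasiMean Θ π ℓ)))

lemma confBound_iff_studentized {Θ : Set (EuclideanSpace ℝ (Fin d))}
    {θ₀ : EuclideanSpace ℝ (Fin d)} {π : EuclideanSpace ℝ (Fin d) → ℝ}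
    {ℓ : EuclideanSpace ℝ (Fin d) → ℝ} {n : ℕ} (hn : 1 ≤ n)
    {Om : Matrix (Fin d) (Fin d) ℝ} {g : EuclideanSpace ℝ (Fin d) → ℝ}
    (hpos : 0 < quadForm (scaledQuasiCov Θ π ℓ n * Om * scaledQuasiCov Θ π ℓ n)
      (gradient g (quasiMean Θ π ℓ))) (p q : ℝ) :
    (confBound Θ π ℓ n Om g p ≤ g θ₀ ∧ g θ₀ ≤ confBound Θ π ℓ n Om g q) ↔
      studentized Θ θ₀ π ℓ n Om g ∈ Set.Icc (stdNormalQuantile p) (stdNormalQuantile q) := by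
  have hs : 0 < Real.sqrt n := Real.sqrt_pos.2 (by exact_mod_cast hn)
  have hσ := Real.sqrt_pos.2 hpos
  unfold confBound studentized
  set σ := Real.sqrt (quadForm (scaledQuasiCov Θ π ℓ n * Om * scaledQuasiCov Θ π ℓ n)
      (gradient g (quasiMean Θ π ℓ)))
  rw [Set.mem_Icc, le_div_iff₀ hσ, div_le_iff₀ hσ, ← le_sub_iff_add_le', ← sub_le_iff_le_add',
    ← mul_div_assoc, ← mul_div_assoc, div_le_iff₀ hs, le_div_iff₀ hs, mul_comm (Real.sqrt n)]

/-- Limits of the studentized statistic and of its variance estimate along a convergent path. -/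
lemma ConvergentPath.tendsto_studentized {S : Type*} {Θ : Set (EuclideanSpace ℝ (Fin d))}
    {θ₀ : EuclideanSpace ℝ (Fin d)} {π : EuclideanSpace ℝ (Fin d) → ℝ}
    {L : ℕ → EuclideanSpace ℝ (Fin d) → S → ℝ} {Δ : ℕ → S → EuclideanSpace ℝ (Fin d)}
    {J Om : ℕ → Matrix (Fin d) (Fin d) ℝ} {OmHat : ℕ → S → Matrix (Fin d) (Fin d) ℝ}
    (hParam : ParameterAssumption Θ θ₀)
    (hPrior : PriorAssumption Θ π) {g : EuclideanSpace ℝ (Fin d) → ℝ}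
    (hg : ContDiffAt ℝ 1 g θ₀) {N : ℕ → ℕ} {ω : ℕ → S}
    {J₀ Om₀ S₀ : Matrix (Fin d) (Fin d) ℝ} {z : EuclideanSpace ℝ (Fin d)}
    (H : ConvergentPath Θ θ₀ L Δ J Om OmHat N ω J₀ Om₀ S₀ z)
    (hOm : Om₀.IsSymm) (hS : S₀.IsSymm) (hOS : Om₀ * (S₀ * S₀) = 1)
    (hσ : 0 < quadForm (J₀⁻¹ * Om₀ * J₀⁻¹) (gradient g θ₀)) :
    (∀ᶠ k in atTop, 0 < quadForm (scaledQuasiCov Θ π (fun θ => L (N k) θ (ω k)) (N k) *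
        OmHat (N k) (ω k) * scaledQuasiCov Θ π (fun θ => L (N k) θ (ω k)) (N k))
        (gradient g (quasiMean Θ π fun θ => L (N k) θ (ω k)))) ∧
      Tendsto (fun k => studentized Θ θ₀ π (fun θ => L (N k) θ (ω k)) (N k) (OmHat (N k) (ω k)) g)
        atTop (𝓝 (-(inner ℝ (WithLp.toLp 2 (S₀ *ᵥ Om₀ *ᵥ J₀⁻¹ *ᵥ (gradient g θ₀).ofLp) :
          EuclideanSpace ℝ (Fin d)) z /
          Real.sqrt (quadForm (J₀⁻¹ * Om₀ * J₀⁻¹) (gradient g θ₀))))) := by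
  obtain ⟨hmean, hcov⟩ :=
    H.quadratic.tendsto_quasiMean_and_scaledQuasiCov_of_assumptions hParam hPrior
  obtain ⟨hgm, hgrad⟩ := tendsto_deltaMethod hg H.size hmean
  have hq := tendsto_quadForm ((hcov.mul H.tendsto_OmHat).mul hcov) hgrad
  refine ⟨hq.eventually_const_lt hσ, ?_⟩
  rw [← (sandwich_identities H.quadratic.limit_curvature_symm hOm hS hOS (gradient g θ₀) z).2]
  have := hgm.neg.div hq.sqrt (Real.sqrt_pos.2 hσ).ne'
  rw [neg_div] at this
  refine this.congr fun k => ?_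
  simp only [Pi.div_apply, studentized]
  ring

section Coverage

variable {S : Type*} [MeasurableSpace S] {P : Measure S} [IsProbabilityMeasure P]
  {Θ : Set (EuclideanSpace ℝ (Fin d))} {θ₀ : EuclideanSpace ℝ (Fin d)}
  {π : EuclideanSpace ℝ (Fin d) → ℝ} {L : ℕ → EuclideanSpace ℝ (Fin d) → S → ℝ} {Δ : ℕ → S → EuclideanSpace ℝ (Fin d)}
  {J Om : ℕ → Matrix (Fin d) (Fin d) ℝ} {OmHat : ℕ → S → Matrix (Fin d) (Fin d) ℝ}

/-- Linear functionals of the standardized score are asymptotically standard normal. -/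
lemma tendsto_measure_inner_stdScore (hExp : ExpansionAssumption P Θ θ₀ L Δ J Om) {N : ℕ → ℕ}
    (hN : Tendsto N atTop atTop) {a : EuclideanSpace ℝ (Fin d)} (ha : ‖a‖ = 1) (b c : ℝ) :
    Tendsto (fun k => P {ω | inner ℝ a (stdScore Om Δ (N k) ω) ∈ (Set.Icc b c)ᶜ}) atTop
      (𝓝 (gaussianReal 0 1 (Set.Icc b c)ᶜ)) := by
  have hcont : Continuous fun z : EuclideanSpace ℝ (Fin d) => inner ℝ a z := by fun_prop
  have hT := hExp.score_clt.continuous_comp hcont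
  have hmap : (stdGaussian (EuclideanSpace ℝ (Fin d))).map
      ((fun z : EuclideanSpace ℝ (Fin d) => inner ℝ a z) ∘ id) = gaussianReal 0 1 :=
    map_inner_stdGaussian ha
  have hfr : gaussianReal 0 1 (frontier (Set.Icc b c)ᶜ) = 0 := by
    have := nullSingletonClass_gaussianReal (μ := 0) (v := 1) one_ne_zero
    rw [frontier_compl]
    refine measure_mono_null (t := {b, c}) ?_ ((Set.toFinite {b, c}).measure_zero _)
    rcases le_or_gt b c with h | h
    · rw [frontier_Icc h]
    · simp [Set.Icc_eq_empty (not_le.2 h)]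
  have hlim := ProbabilityMeasure.tendsto_measure_of_null_frontier_of_tendsto' hT.tendsto
    (E := (Set.Icc b c)ᶜ) (by simp only [ProbabilityMeasure.coe_mk]; rw [hmap]; exact hfr)
  simp only [ProbabilityMeasure.coe_mk] at hlim
  rw [hmap] at hlim
  refine (hlim.comp hN).congr fun k => ?_
  exact Measure.map_apply_of_aemeasurable (hT.forall_aemeasurable (N k)) measurableSet_Icc.compl

/-- Coverage along a subsequence of sample sizes for which the matrices converge. -/
lemma tendsto_coverage_of_tendsto_matrices (hParam : ParameterAssumption Θ θ₀)
    (hPrior : PriorAssumption Θ π) (hMeas : CriterionMeasurable Θ L)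
    (hIdent : IdentifiabilityAssumption P Θ θ₀ L) (hExp : ExpansionAssumption P Θ θ₀ L Δ J Om)
    (hOmHat : MatrixTendstoInProb P (fun n ω => OmHat n ω * (Om n)⁻¹) 1)
    {g : EuclideanSpace ℝ (Fin d) → ℝ} (hg : ContDiffAt ℝ 1 g θ₀) (hg0 : gradient g θ₀ ≠ 0)
    {N : ℕ → ℕ} (hN : Tendsto N atTop atTop) {J₀ Om₀ S₀ : Matrix (Fin d) (Fin d) ℝ}
    (hJ₀ : Tendsto (fun k => J (N k)) atTop (𝓝 J₀))
    (hOm₀ : Tendsto (fun k => Om (N k)) atTop (𝓝 Om₀))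
    (hS₀ : Tendsto (fun k => CFC.sqrt (Om (N k))⁻¹) atTop (𝓝 S₀)) (p q : ℝ) :
    Tendsto (fun k => innerProb P
      {ω | confBound Θ π (fun θ => L (N k) θ ω) (N k) (OmHat (N k) ω) g p ≤ g θ₀ ∧
        g θ₀ ≤ confBound Θ π (fun θ => L (N k) θ ω) (N k) (OmHat (N k) ω) g q}) atTop
      (𝓝 (ENNReal.ofReal (cdf (gaussianReal 0 1) (stdNormalQuantile q) -
        cdf (gaussianReal 0 1) (stdNormalQuantile p)))) := by
  have hone := hN.eventually_ge_atTop 1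
  obtain ⟨hOS, hSs⟩ := limit_mul_sqrt_mul_sqrt hExp.variance hN hOm₀ hS₀
  have hsymm : ∀ {A : ℕ → Matrix (Fin d) (Fin d) ℝ} {A₀ : Matrix (Fin d) (Fin d) ℝ},
      BoundedUniformlyPosDef A → Tendsto (fun k => A (N k)) atTop (𝓝 A₀) →
      A₀.IsSymm ∧ A₀.PosDef := by
    intro A A₀ hA hlim
    obtain ⟨c, hc, hpos⟩ := hA.uniformly_pos
    have h1 : A₀.IsSymm := tendsto_nhds_unique_of_eventuallyEq
      ((Continuous.matrix_transpose continuous_id).tendsto A₀ |>.comp hlim) hlim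
      (hone.mono fun k hk => hA.isSymm _ hk)
    exact ⟨h1, posDef_of_quadForm h1 hc fun x => ge_of_tendsto
      (tendsto_quadForm hlim tendsto_const_nhds) (hone.mono fun k hk => hpos _ hk x)⟩
  obtain ⟨hJs, hJpd⟩ := hsymm hExp.curvature hJ₀
  obtain ⟨hOs, -⟩ := hsymm hExp.variance hOm₀
  set v := gradient g θ₀ with hv
  set w : EuclideanSpace ℝ (Fin d) := WithLp.toLp 2 (S₀ *ᵥ Om₀ *ᵥ J₀⁻¹ *ᵥ v.ofLp) with hw
  have hwσ : ‖w‖ ^ 2 = quadForm (J₀⁻¹ * Om₀ * J₀⁻¹) v :=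
    (sandwich_identities hJs hOs hSs hOS v 0).1
  have hJdet := (isUnit_iff_isUnit_det _).1 hJpd.isUnit
  -- `w = 0` would force `v = 0`, because `J₀ S₀ (S₀ Om₀ J₀⁻¹) = 1`
  have hw0 : w ≠ 0 := by
    intro h0
    have h1 : S₀ *ᵥ Om₀ *ᵥ J₀⁻¹ *ᵥ v.ofLp = 0 := by
      rw [hw] at h0
      simpa using h0
    have h2 : J₀ *ᵥ S₀ *ᵥ S₀ *ᵥ Om₀ *ᵥ J₀⁻¹ *ᵥ v.ofLp = v.ofLp := by
      simp only [mulVec_mulVec]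
      rw [show J₀ * (S₀ * (S₀ * (Om₀ * J₀⁻¹))) = J₀ * (S₀ * S₀ * Om₀) * J₀⁻¹ by
        simp only [mul_assoc], mul_eq_one_comm.1 hOS, mul_one, mul_nonsing_inv _ hJdet, one_mulVec]
    rw [h1, mulVec_zero, mulVec_zero] at h2
    exact hg0 (by ext i; simpa using (congrFun h2 i).symm)
  have hσpos : 0 < quadForm (J₀⁻¹ * Om₀ * J₀⁻¹) v := by
    rw [← hwσ]
    have := norm_pos_iff.2 hw0
    positivity
  set σ := Real.sqrt (quadForm (J₀⁻¹ * Om₀ * J₀⁻¹) v) with hσ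
  have hσn : σ = ‖w‖ := by rw [hσ, ← hwσ, Real.sqrt_sq (norm_nonneg _)]
  set a : EuclideanSpace ℝ (Fin d) := (-σ⁻¹) • w with ha
  have ha1 : ‖a‖ = 1 := by
    rw [ha, norm_smul, norm_neg, norm_inv, hσn, norm_norm, inv_mul_cancel₀ (norm_ne_zero_iff.2 hw0)]
  refine tendsto_innerProb_of_close (T := fun k ω => inner ℝ a (stdScore Om Δ (N k) ω))
    (W := fun k ω => studentized Θ θ₀ π (fun θ => L (N k) θ ω) (N k) (OmHat (N k) ω) g)
    (tendsto_measure_inner_stdScore hExp hN ha1) fun η hη => ?_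
  by_contra hcon
  obtain ⟨φ, hφ, ω, hω, J₁, Om₁, S₁, z, hp⟩ :=
    exists_convergentPath hMeas hIdent hExp hOmHat hN hcon
  obtain rfl := tendsto_nhds_unique hp.quadratic.tendsto_curvature (hJ₀.comp hφ.tendsto_atTop)
  obtain rfl := tendsto_nhds_unique hp.tendsto_Om (hOm₀.comp hφ.tendsto_atTop)
  obtain rfl := tendsto_nhds_unique hp.tendsto_sqrt (hS₀.comp hφ.tendsto_atTop)
  obtain ⟨hpos, hstud⟩ := hp.tendsto_studentized hParam hPrior hg hOs hSs hOS hσpos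
  have hT : Tendsto (fun k => inner ℝ a (stdScore Om Δ (N (φ k)) (ω k))) atTop
      (𝓝 (inner ℝ a z)) := tendsto_const_nhds.inner hp.tendsto_stdScore
  have hlim : -(inner ℝ w z / σ) = inner ℝ a z := by
    rw [ha, real_inner_smul_left]
    ring
  have hdiff := (hstud.sub hT).abs
  rw [← hv, ← hw, ← hσ, hlim, sub_self, abs_zero] at hdiff
  obtain ⟨k, hk1, hk2, hk3⟩ := (hpos.and ((hdiff.eventually_lt_const hη).and
    (hp.size.eventually_ge_atTop 1))).exists
  rcases hω k with h | h
  · exact h (confBound_iff_studentized hk3 hk1 p q)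
  · exact absurd h (not_le.2 hk2)

end Coverage

theorem theorem4 {d : ℕ} {S : Type*} [MeasurableSpace S] (P : Measure S) [IsProbabilityMeasure P]
    (Θ : Set (EuclideanSpace ℝ (Fin d))) (θ₀ : EuclideanSpace ℝ (Fin d))
    (π : EuclideanSpace ℝ (Fin d) → ℝ)
    (L : ℕ → EuclideanSpace ℝ (Fin d) → S → ℝ)
    (Δ : ℕ → S → EuclideanSpace ℝ (Fin d))
    (J Om : ℕ → Matrix (Fin d) (Fin d) ℝ)
    (hParam : ParameterAssumption Θ θ₀)
    (hPrior : PriorAssumption Θ π)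
    (hMeas : CriterionMeasurable Θ L)
    (hIdent : IdentifiabilityAssumption P Θ θ₀ L)
    (hExp : ExpansionAssumption P Θ θ₀ L Δ J Om) :
    -- `n` times the quasi-posterior covariance is consistent for the inverse of `J_n`
    MatrixTendstoInProb P
      (fun n ω => scaledQuasiCov Θ π (fun θ => L n θ ω) n - (J n)⁻¹) 0 ∧
    -- and its inverse is consistent for `J_n`, in the relative sense
    MatrixTendstoInProb P
      (fun n ω => (scaledQuasiCov Θ π (fun θ => L n θ ω) n)⁻¹ * (J n)⁻¹) 1 ∧
    -- the delta-method intervals have asymptotic coverage `1 - α`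
    ∀ OmHat : ℕ → S → Matrix (Fin d) (Fin d) ℝ,
      MatrixTendstoInProb P (fun n ω => OmHat n ω * (Om n)⁻¹) 1 →
      ∀ g : EuclideanSpace ℝ (Fin d) → ℝ,
        ContDiffOn ℝ 1 g (interior Θ) → gradient g θ₀ ≠ 0 →
        ∀ α : ℝ, 0 < α → α < 1 →
          Tendsto
            (fun n : ℕ => innerProb P
              {ω | confBound Θ π (fun θ => L n θ ω) n (OmHat n ω) g (α / 2) ≤ g θ₀ ∧
                g θ₀ ≤ confBound Θ π (fun θ => L n θ ω) n (OmHat n ω) g (1 - α / 2)})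
            atTop (𝓝 (ENNReal.ofReal (1 - α))) := by
  refine ⟨?_, ?_, ?_⟩
  · refine matrixTendstoInProb_of_paths hMeas hIdent hExp fun N ω J₀ Om₀ S₀ z hp => ?_
    have hcov :=
      (hp.quadratic.tendsto_quasiMean_and_scaledQuasiCov_of_assumptions hParam hPrior).2
    have hJi := tendsto_matrix_inv hp.quadratic.limit_posDef.isUnit hp.quadratic.tendsto_curvature
    simpa using hcov.sub hJi
  · refine matrixTendstoInProb_of_paths hMeas hIdent hExp fun N ω J₀ Om₀ S₀ z hp => ?_
    have hcov :=
      (hp.quadratic.tendsto_quasiMean_and_scaledQuasiCov_of_assumptions hParam hPrior).2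
    have hpd := hp.quadratic.limit_posDef
    have hdet := (isUnit_iff_isUnit_det _).1 hpd.isUnit
    have hJi := tendsto_matrix_inv hpd.isUnit hp.quadratic.tendsto_curvature
    have := (tendsto_matrix_inv hpd.inv.isUnit hcov).mul hJi
    rwa [nonsing_inv_nonsing_inv _ hdet, mul_nonsing_inv _ hdet] at this
  · intro OmHat hOmHat g hg hg0 α hα0 hα1
    have hgat : ContDiffAt ℝ 1 g θ₀ :=
      hg.contDiffAt (isOpen_interior.mem_nhds hParam.mem_interior)
    refine tendsto_of_subseq_tendsto fun ns hns => ?_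
    obtain ⟨φ, hφ, J₀, Om₀, S₀, hJ₀, hOm₀, hS₀⟩ :=
      exists_subseq_matrices hExp.curvature hExp.variance hns
    refine ⟨φ, ?_⟩
    have := tendsto_coverage_of_tendsto_matrices hParam hPrior hMeas hIdent hExp hOmHat hgat hg0
      (hns.comp hφ.tendsto_atTop) hJ₀ hOm₀ hS₀ (α / 2) (1 - α / 2)
    rw [cdf_stdNormalQuantile (by linarith) (by linarith),
      cdf_stdNormalQuantile (by linarith) (by linarith),
      show 1 - α / 2 - α / 2 = 1 - α by ring] at this
    exact this
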